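/- Let $\lambda,\mu>0$ and $d\ge 0$. Consider the M/M/1/1 system: packets arrive with i.i.d. $\mathrm{Exp}(\lambda)$ inter-arrival times, starting at time $0$ with an idle server; there is no queue, a packet arriving while the server is busy is discarded, and otherwise its service starts immediately and is not interrupted; the service times $X_0,X_1,\dots$ of the served packets are i.i.d. $\mathrm{Exp}(\mu)$ and independent of the arrivals. Let $T_A(k)$ and $T_D(k)=T_A(k)+X_k$ be the arrival and departure instants of the $k$-th served packet, $k=0,1,2,\dots$. Let $\Delta(t)=t-\max\{T_A(n):T_D(n)\le t\}$ be the age of information at time $t$ (with $\Delta(t)=t$ before the first departure). For $k\ge 1$ let $g(k)$ be the total length of time in $[T_D(k-1),T_D(k))$ during which $\Delta>d$, and let $\nu=1/\mathbb{E}[T_D(k)-T_D(k-1)]$ be the expected departure rate. Then for every $k\ge 1$ the random variables $T_D(k)-T_D(k-1)$ and $g(k)$ are integrable, $$\frac1\nu=\frac1\lambda+\frac1\mu ,$$ $$\mathbb{E}[g(k)]=\begin{cases}\dfrac{\mu^2\left(e^{-\lambda d}-e^{-\mu d}\right)}{\lambda(\mu-\lambda)^2}+e^{-\mu d}\left(\dfrac1\lambda+\dfrac1\mu-\dfrac{\lambda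 d}{\mu-\lambda}\right), & \lambda\ne\mu,\\[2ex] \dfrac{\mu e^{-\mu d}}{2}\left(d+\dfrac2\mu\right)^2, & \lambda=\mu,\end{cases}$$ and the violation probability $\lim_{t\to\infty}\mathbb{P}(\Delta(t)>d)$, if this limit exists, equals $\nu\,\mathbb{E}[g(k)]$. Moreover, almost surely, the fraction of the time interval $[0,T]$ during which $\Delta>d$ converges to $\nu\,\mathbb{E}[g(k)]$ as $T\to\infty$. -/

import Mathlib

open MeasureTheory ProbabilityTheory Filter Topology

/-! Sample paths of a single-server system without a queue.  `z n` is the `n`-th inter-arrival time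
of the source (arrivals start after time `0`, with the server idle), and `x k` is the service time
of the `k`-th packet that is served.  Packets that find the server busy are discarded and receive no
index `k`.  Served packets are indexed by `k = 0, 1, 2, …`. -/

namespace AoI

/-- Time of the `n`-th arrival of the source, discarded arrivals included:
`z 0 + z 1 + ⋯ + z n`. -/
def sourceArrival (z : ℕ → ℝ) (n : ℕ) : ℝ := ∑ i ∈ Finset.range (n + 1), z i

/-- Index, among all arrivals of the source, of the `k`-th packet that is served: the very first
arrival for `k = 0`, and then the first later arrival that finds the server idle.  (The infimum is
over a nonempty set as soon as the arrival times are unbounded.) -/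
noncomputable def servedIndex (z x : ℕ → ℝ) : ℕ → ℕ
  | 0 => 0
  | k + 1 => sInf {n | servedIndex z x k < n ∧
      sourceArrival z (servedIndex z x k) + x k ≤ sourceArrival z n}

/-- `T_A(k)`: arrival instant of the `k`-th served packet. -/
noncomputable def arrivalTime (z x : ℕ → ℝ) (k : ℕ) : ℝ := sourceArrival z (servedIndex z x k)

/-- `T_D(k)`: departure instant of the `k`-th served packet; service starts upon arrival. -/
noncomputable def departureTime (z x : ℕ → ℝ) (k : ℕ) : ℝ := arrivalTime z x k + x k

/-- The age of information `Δ(t) = t - max {T_A(n) : T_D(n) ≤ t}`.  (Before the first departure the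
set is empty and this reads `Δ(t) = t`.) -/
noncomputable def age (z x : ℕ → ℝ) (t : ℝ) : ℝ :=
  t - sSup {a | ∃ n, departureTime z x n ≤ t ∧ arrivalTime z x n = a}

/-- `g(k)`, for `k ≥ 1`: the duration for which the age exceeds `d` between the departures of the
packets `k - 1` and `k`, that is, between two successive peaks of the age. -/
noncomputable def exceedanceTime (z x : ℕ → ℝ) (d : ℝ) (k : ℕ) : ℝ :=
  volume.real {t | t ∈ Set.Ico (departureTime z x (k - 1)) (departureTime z x k) ∧ d < age z x t}

/-- Fraction of the time interval `[0, T]` during which the age exceeds `d`. -/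
noncomputable def exceedanceFraction (z x : ℕ → ℝ) (d T : ℝ) : ℝ :=
  volume.real {t | t ∈ Set.Icc 0 T ∧ d < age z x t} / T

variable {Ω : Type*} [MeasurableSpace Ω]

/-- The M/M/1/1 input: inter-arrival times `Z n` with law `Exp(lam)` and service times `X k` with law
`Exp(mu)`, all of them jointly independent. -/
structure IsMM11 (P : Measure Ω) (Z X : ℕ → Ω → ℝ) (lam mu : ℝ) : Prop where
  measurable_interarrival : ∀ n, Measurable (Z n)
  measurable_service : ∀ k, Measurable (X k)
  map_interarrival : ∀ n, P.map (Z n) = expMeasure lam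
  map_service : ∀ k, P.map (X k) = expMeasure mu
  indep : iIndepFun (Sum.elim Z X) P

/-- Inter-departure time `T_D(k) - T_D(k-1)`, for `k ≥ 1`, as a random variable. -/
noncomputable def interDeparture (Z X : ℕ → Ω → ℝ) (k : ℕ) (ω : Ω) : ℝ :=
  departureTime (fun n => Z n ω) (fun n => X n ω) k -
    departureTime (fun n => Z n ω) (fun n => X n ω) (k - 1)

/-- The expected departure rate `ν = 1 / E[T_D(k) - T_D(k-1)]`. -/
noncomputable def departureRate (P : Measure Ω) (Z X : ℕ → Ω → ℝ) (k : ℕ) : ℝ :=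
  1 / ∫ ω, interDeparture Z X k ω ∂P

/-- `g(k)` as a random variable. -/
noncomputable def g (Z X : ℕ → Ω → ℝ) (d : ℝ) (k : ℕ) (ω : Ω) : ℝ :=
  exceedanceTime (fun n => Z n ω) (fun n => X n ω) d k

/-- `P(Δ(t) > d)`. -/
noncomputable def violationProb (P : Measure Ω) (Z X : ℕ → Ω → ℝ) (d t : ℝ) : ℝ :=
  P.real {ω | d < age (fun n => Z n ω) (fun n => X n ω) t}

end AoI

/-! The exponential law has no memory: seen from the end of a service, the stream of arrivals is
again a stream of i.i.d. `Exp(lam)` gaps, whatever happened before.  Hence the idle periods `I_k`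
are i.i.d. with law `Exp(lam)` and independent of the services, and the time between two departures
is `I_k + X_{k+1}`.  The age equals `X_k` at the `k`-th departure and grows at unit speed until the
next one, so that it exceeds `d` for a time `(I_k + X_{k+1} - (d - X_k)⁺)⁺`, whose mean is an
integral of products of exponential tails.

Two cycles that are not adjacent share no service and are independent, which suffices for the strong
law of large numbers; the long-run fraction of time is then the ratio of the means, as in
renewal-reward theory.  By Fubini and dominated convergence, the same ratio is the limit of the time
averages of `P(Δ(t) > d)`, hence the limit of `P(Δ(t) > d)` if there is one. -/

namespace AoI

open scoped ENNReal

/-! ### The exponential distribution -/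

instance isProbabilityMeasure_exp (r : ℝ) [hr : Fact (0 < r)] :
    IsProbabilityMeasure (expMeasure r) := isProbabilityMeasure_expMeasure hr.out

instance nullSingletonClass_expMeasure (r : ℝ) : NullSingletonClass (expMeasure r) :=
  inferInstanceAs (NullSingletonClass (volume.withDensity (gammaPDF 1 r)))

lemma lintegral_expMeasure (r : ℝ) {f : ℝ → ℝ≥0∞} (hf : Measurable f) :
    ∫⁻ u, f u ∂(expMeasure r) =
      ∫⁻ u, (Set.Ici 0).indicator (fun u => ENNReal.ofReal (r * Real.exp (-(r * u))) * f u) u := by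
  change ∫⁻ u, f u ∂(volume.withDensity (exponentialPDF r)) = _
  have hpdf : Measurable (exponentialPDF r) := (measurable_exponentialPDFReal r).ennreal_ofReal
  rw [lintegral_withDensity_eq_lintegral_mul _ hpdf hf]
  refine lintegral_congr fun u => ?_
  by_cases hu : 0 ≤ u <;> simp [exponentialPDF_eq, hu]

lemma setLIntegral_Ici_comp_sub_expMeasure (r : ℝ) {x : ℝ} (hx : 0 ≤ x) {f : ℝ → ℝ≥0∞}
    (hf : Measurable f) :
    ∫⁻ u in Set.Ici x, f (u - x) ∂(expMeasure r) =
      ENNReal.ofReal (Real.exp (-(r * x))) * ∫⁻ u, f u ∂(expMeasure r) := by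
  rw [← lintegral_indicator measurableSet_Ici, lintegral_expMeasure r hf,
    lintegral_expMeasure r (Measurable.indicator (by fun_prop) measurableSet_Ici),
    ← lintegral_const_mul' _ _ ENNReal.ofReal_ne_top,
    ← lintegral_add_right_eq_self _ x]
  refine lintegral_congr fun u => ?_
  by_cases hu : 0 ≤ u
  · have hux : 0 ≤ u + x := by positivity
    simp only [Set.indicator, Set.mem_Ici, hu, hux, if_true, le_add_iff_nonneg_left,
      add_sub_cancel_right]
    rw [← mul_assoc, ← ENNReal.ofReal_mul (Real.exp_pos _).le]
    congr 2
    rw [mul_left_comm, ← Real.exp_add]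
    ring_nf
  · by_cases hux : 0 ≤ u + x <;> simp [Set.indicator, hu, hux]

lemma expMeasure_Ioi (r : ℝ) [Fact (0 < r)] {x : ℝ} (hx : 0 ≤ x) :
    expMeasure r (Set.Ioi x) = ENNReal.ofReal (Real.exp (-(r * x))) := by
  rw [measure_congr Ioi_ae_eq_Ici]
  simpa using setLIntegral_Ici_comp_sub_expMeasure r hx (f := fun _ => 1) measurable_const

lemma ae_pos_expMeasure (r : ℝ) [Fact (0 < r)] : ∀ᵐ u ∂(expMeasure r), 0 < u :=
  (mem_ae_iff_prob_eq_one measurableSet_Ioi).2 (by simp [expMeasure_Ioi r le_rfl])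

lemma expMeasure_Ioi_eq_exp_max (r : ℝ) [Fact (0 < r)] (x : ℝ) :
    expMeasure r (Set.Ioi x) = ENNReal.ofReal (Real.exp (-(r * max x 0))) := by
  rcases le_total 0 x with hx | hx
  · rw [expMeasure_Ioi r hx, max_eq_left hx]
  · have hae : ∀ᵐ u ∂(expMeasure r), u ∈ Set.Ioi x :=
      (ae_pos_expMeasure r).mono fun u hu => hx.trans_lt hu
    simp [(mem_ae_iff_prob_eq_one measurableSet_Ioi).1 hae, max_eq_right hx]

lemma integrableOn_exp_neg_mul_Ioi {r : ℝ} (hr : 0 < r) (a : ℝ) :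
    IntegrableOn (fun s => Real.exp (-(r * s))) (Set.Ioi a) := by
  simpa only [neg_mul] using integrableOn_exp_mul_Ioi (neg_neg_of_pos hr) a

lemma lintegral_ofReal_expMeasure (r : ℝ) [hr : Fact (0 < r)] :
    ∫⁻ u, ENNReal.ofReal u ∂(expMeasure r) = ENNReal.ofReal (1 / r) := by
  have hmean : ∫ t in Set.Ioi (0 : ℝ), Real.exp (-(r * t)) = 1 / r := by
    simpa using integral_exp_mul_Ioi (neg_neg_of_pos hr.out) 0
  have htail : ∀ t ∈ Set.Ioi (0 : ℝ), expMeasure r {u | t < u} =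
      ENNReal.ofReal (Real.exp (-(r * t))) := fun t ht => expMeasure_Ioi r (le_of_lt ht)
  rw [lintegral_eq_lintegral_meas_lt (f := fun u => u) (expMeasure r)
    ((ae_pos_expMeasure r).mono fun u hu => hu.le) aemeasurable_id,
    setLIntegral_congr_fun measurableSet_Ioi htail,
    ← ofReal_integral_eq_lintegral_ofReal (integrableOn_exp_neg_mul_Ioi hr.out 0)
      (ae_of_all _ fun _ => (Real.exp_pos _).le), hmean]

lemma integrable_id_expMeasure (r : ℝ) [Fact (0 < r)] :
    Integrable (fun u => u) (expMeasure r) := by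
  refine ⟨aestronglyMeasurable_id, ?_⟩
  rw [hasFiniteIntegral_iff_ofReal ((ae_pos_expMeasure r).mono fun u hu => hu.le),
    lintegral_ofReal_expMeasure]
  exact ENNReal.ofReal_lt_top

lemma integral_id_expMeasure (r : ℝ) [hr : Fact (0 < r)] : ∫ u, u ∂(expMeasure r) = 1 / r := by
  rw [integral_eq_lintegral_of_nonneg_ae ((ae_pos_expMeasure r).mono fun u hu => hu.le)
    aestronglyMeasurable_id, lintegral_ofReal_expMeasure,
    ENNReal.toReal_ofReal (one_div_pos.2 hr.out).le]

lemma integral_id_expMeasure_pos (r : ℝ) [hr : Fact (0 < r)] : 0 < ∫ u, u ∂(expMeasure r) := by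
  rw [integral_id_expMeasure]
  exact one_div_pos.2 hr.out

lemma integrable_of_map_eq_expMeasure {r : ℝ} [Fact (0 < r)] {Ω : Type*} [MeasurableSpace Ω]
    {P : Measure Ω} {Y : Ω → ℝ} (hY : Measurable Y) (hlaw : P.map Y = expMeasure r) :
    Integrable Y P :=
  (integrable_map_measure (f := Y) aestronglyMeasurable_id hY.aemeasurable).1
    (hlaw.symm ▸ integrable_id_expMeasure r)

lemma integral_of_map_eq_expMeasure {r : ℝ} [Fact (0 < r)] {Ω : Type*} [MeasurableSpace Ω]
    {P : Measure Ω} {Y : Ω → ℝ} (hY : Measurable Y) (hlaw : P.map Y = expMeasure r) :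
    ∫ ω, Y ω ∂P = 1 / r := by
  rw [← integral_id_expMeasure r, ← hlaw]
  exact (integral_map (f := fun u => u) hY.aemeasurable aestronglyMeasurable_id).symm

/-! ### Independent families -/

section Independence

variable {Ω ι κ ι' : Type*} {mΩ : MeasurableSpace Ω} {P : Measure Ω}

lemma indepFun_comp_of_disjoint_range {𝓧 : Type*} [MeasurableSpace 𝓧] [IsZeroOrProbabilityMeasure P]
    {X : ι → Ω → 𝓧} (hX : ∀ i, Measurable (X i)) (h : iIndepFun X P) {f : κ → ι} {g : ι' → ι}
    (hfg : Disjoint (Set.range f) (Set.range g)) :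
    IndepFun (fun ω a => X (f a) ω) (fun ω b => X (g b) ω) P := by
  classical
  refine IndepFun.process_indepFun_process (fun a => hX (f a)) (fun b => hX (g b)) fun I J => ?_
  have hIJ : Disjoint (I.image f) (J.image g) := by
    rw [← Finset.disjoint_coe, Finset.coe_image, Finset.coe_image]
    exact hfg.mono (Set.image_subset_range _ _) (Set.image_subset_range _ _)
  exact (h.indepFun_finset _ _ hIJ hX).comp
    (φ := fun y (a : I) => y ⟨f a, Finset.mem_image_of_mem f a.2⟩)
    (ψ := fun y (b : J) => y ⟨g b, Finset.mem_image_of_mem g b.2⟩)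
    (by fun_prop) (by fun_prop)

lemma iIndepFun_sumElim {𝓧 : Type*} [MeasurableSpace 𝓧] [IsProbabilityMeasure P]
    {U : ι → Ω → 𝓧} {V : κ → Ω → 𝓧} (hU : iIndepFun U P)
    (hV : iIndepFun V P) (hUV : IndepFun (fun ω i => U i ω) (fun ω j => V j ω) P) :
    iIndepFun (Sum.elim U V) P := by
  refine iIndepFun_iff_measure_inter_preimage_eq_mul.2 fun s t ht => ?_
  have hsplit : ⋂ i ∈ s, Sum.elim U V i ⁻¹' t i =
      (fun ω i => U i ω) ⁻¹' Set.pi s.toLeft (fun i => t (Sum.inl i)) ∩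
        (fun ω j => V j ω) ⁻¹' Set.pi s.toRight (fun j => t (Sum.inr j)) := by
    ext ω
    simp [Set.mem_pi]
  have hleft : (fun ω i => U i ω) ⁻¹' Set.pi s.toLeft (fun i => t (Sum.inl i)) =
      ⋂ i ∈ s.toLeft, U i ⁻¹' t (Sum.inl i) := by
    ext ω; simp [Set.mem_pi]
  have hright : (fun ω j => V j ω) ⁻¹' Set.pi s.toRight (fun j => t (Sum.inr j)) =
      ⋂ j ∈ s.toRight, V j ⁻¹' t (Sum.inr j) := by
    ext ω; simp [Set.mem_pi]
  rw [hsplit, hUV.measure_inter_preimage_eq_mul _ _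
    (.pi (Finset.countable_toSet _) fun i hi => ht _ (Finset.mem_toLeft.1 hi))
    (.pi (Finset.countable_toSet _) fun j hj => ht _ (Finset.mem_toRight.1 hj)), hleft, hright,
    hU.measure_inter_preimage_eq_mul _ fun i hi => ht _ (Finset.mem_toLeft.1 hi),
    hV.measure_inter_preimage_eq_mul _ fun j hj => ht _ (Finset.mem_toRight.1 hj)]
  conv_rhs => rw [← Finset.toLeft_disjSum_toRight (u := s), Finset.prod_disjSum]
  rfl

end Independence

/-- Law of a sequence of independent random variables with law `ρ`. -/
noncomputable abbrev iidLaw (ρ : Measure ℝ) : Measure (ℕ → ℝ) := Measure.infinitePi fun _ => ρ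

/-- The sequence with its first term dropped. -/
def tail (z : ℕ → ℝ) : ℕ → ℝ := fun j => z (j + 1)

/-- The sequence with one term added in front. -/
def cons (a : ℝ) (z : ℕ → ℝ) : ℕ → ℝ
  | 0 => a
  | j + 1 => z j

@[simp] lemma cons_zero (a : ℝ) (z : ℕ → ℝ) : cons a z 0 = a := rfl

@[simp] lemma cons_succ (a : ℝ) (z : ℕ → ℝ) (j : ℕ) : cons a z (j + 1) = z j := rfl

@[simp] lemma tail_cons (a : ℝ) (z : ℕ → ℝ) : tail (cons a z) = z := rfl

lemma cons_tail (z : ℕ → ℝ) : cons (z 0) (tail z) = z := by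
  funext j; cases j <;> rfl

@[fun_prop]
lemma measurable_tail : Measurable tail := by unfold tail; fun_prop

lemma measurable_cons : Measurable fun p : ℝ × (ℕ → ℝ) => cons p.1 p.2 := by
  refine measurable_pi_iff.2 fun j => ?_
  cases j <;> simp only [cons_zero, cons_succ] <;> fun_prop

lemma measurePreserving_headTail (ρ : Measure ℝ) [IsProbabilityMeasure ρ] :
    MeasurePreserving (fun z : ℕ → ℝ => (z 0, tail z)) (iidLaw ρ) (ρ.prod (iidLaw ρ)) := by
  have hcoord : iIndepFun (fun i (z : ℕ → ℝ) => z i) (iidLaw ρ) :=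
    iIndepFun_infinitePi (X := fun _ u => u) fun _ => measurable_id
  have htail : (iidLaw ρ).map tail = iidLaw ρ :=
    Measure.map_infinitePi_infinitePi_of_inj (add_left_injective 1)
  have hind : IndepFun (fun z : ℕ → ℝ => z 0) tail (iidLaw ρ) :=
    (indepFun_comp_of_disjoint_range (fun i => measurable_pi_apply i) hcoord
      (f := fun _ : Unit => 0) (g := fun n => n + 1) (by simp)).comp
      (measurable_pi_apply ()) measurable_id
  refine ⟨(measurable_pi_apply 0).prodMk measurable_tail, ?_⟩
  rw [hind.map_prod_eq_prod_map_map (measurable_pi_apply 0).aemeasurable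
    measurable_tail.aemeasurable, htail, (measurePreserving_eval_infinitePi _ 0).map_eq]

lemma measurePreserving_tail (ρ : Measure ℝ) [IsProbabilityMeasure ρ] :
    MeasurePreserving tail (iidLaw ρ) (iidLaw ρ) :=
  measurePreserving_snd.comp (measurePreserving_headTail ρ)

lemma measurePreserving_cons (ρ : Measure ℝ) [IsProbabilityMeasure ρ] :
    MeasurePreserving (fun p : ℝ × (ℕ → ℝ) => cons p.1 p.2) (ρ.prod (iidLaw ρ)) (iidLaw ρ) := by
  refine ⟨measurable_cons, ?_⟩
  rw [← (measurePreserving_headTail ρ).map_eq,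
    Measure.map_map measurable_cons (measurePreserving_headTail ρ).measurable]
  simp only [Function.comp_def, cons_tail, Measure.map_id']

/-! ### Memorylessness of a Poisson stream -/

lemma tendsto_atTop_of_tendsto_div_natCast {u : ℕ → ℝ} {c : ℝ} (hc : 0 < c)
    (h : Tendsto (fun n : ℕ => u n / n) atTop (𝓝 c)) : Tendsto u atTop atTop := by
  refine (h.pos_mul_atTop hc tendsto_natCast_atTop_atTop).congr' ?_
  filter_upwards [eventually_ne_atTop 0] with n hn
  exact div_mul_cancel₀ _ (Nat.cast_ne_zero.2 hn)

@[fun_prop]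
lemma measurable_sourceArrival (n : ℕ) : Measurable fun z => sourceArrival z n := by
  unfold sourceArrival; fun_prop

lemma sourceArrival_zero (z : ℕ → ℝ) : sourceArrival z 0 = z 0 := by simp [sourceArrival]

lemma sourceArrival_cons_zero (u : ℝ) (z : ℕ → ℝ) : sourceArrival (cons u z) 0 = u :=
  sourceArrival_zero _

lemma sourceArrival_cons_succ (u : ℝ) (z : ℕ → ℝ) (n : ℕ) :
    sourceArrival (cons u z) (n + 1) = u + sourceArrival z n := by
  rw [sourceArrival, Finset.sum_range_succ', add_comm]
  rfl

lemma sourceArrival_add (z : ℕ → ℝ) (m n : ℕ) :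
    sourceArrival z (m + 1 + n) =
      sourceArrival z m + sourceArrival (fun j => z (m + 1 + j)) n := by
  unfold sourceArrival
  rw [add_assoc (m + 1) n 1, Finset.sum_range_add]

lemma ae_tendsto_sourceArrival {ρ : Measure ℝ} [IsProbabilityMeasure ρ]
    (hint : Integrable (fun u => u) ρ) (hpos : 0 < ∫ u, u ∂ρ) :
    ∀ᵐ z ∂(iidLaw ρ), Tendsto (sourceArrival z) atTop atTop := by
  have heval := fun i : ℕ => measurePreserving_eval_infinitePi (fun _ : ℕ => ρ) i
  have hident : ∀ i, IdentDistrib (fun z : ℕ → ℝ => z i) (fun z => z 0) (iidLaw ρ) (iidLaw ρ) :=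
    fun i => ⟨(measurable_pi_apply i).aemeasurable, (measurable_pi_apply 0).aemeasurable,
      (heval i).map_eq.trans (heval 0).map_eq.symm⟩
  have hind := iIndepFun_infinitePi (P := fun _ : ℕ => ρ) (X := fun _ u => u) fun _ =>
    measurable_id
  have hmean : ∫ z : ℕ → ℝ, z 0 ∂(iidLaw ρ) = ∫ u, u ∂ρ :=
    (heval 0).hasLaw.integral_comp aestronglyMeasurable_id
  filter_upwards [strong_law_ae_real (fun i (z : ℕ → ℝ) => z i)
    ((heval 0).integrable_comp_of_integrable hint) (fun i j hij => hind.indepFun hij)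
    hident] with z hz
  rw [hmean] at hz
  exact (tendsto_atTop_of_tendsto_div_natCast hpos hz).comp (tendsto_add_atTop_nat 1)

/-- The streams `z` of gaps whose `m`-th arrival is the first one that is not before `x`. -/
def passageSet (m : ℕ) (x : ℝ) : Set (ℕ → ℝ) :=
  {z | (∀ i < m, sourceArrival z i < x) ∧ x ≤ sourceArrival z m}

/-- The gaps of the stream `z` seen from time `x`, when its `m`-th arrival is the next one:
the time from `x` to that arrival, followed by the later gaps. -/
def restart (m : ℕ) (x : ℝ) (z : ℕ → ℝ) : ℕ → ℝ :=
  cons (sourceArrival z m - x) fun j => z (m + 1 + j)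

lemma measurable_restart (m : ℕ) :
    Measurable fun p : ℝ × (ℕ → ℝ) => restart m p.1 p.2 :=
  measurable_cons.comp (f := fun p : ℝ × (ℕ → ℝ) =>
    (sourceArrival p.2 m - p.1, fun j => p.2 (m + 1 + j))) (by fun_prop)

lemma measurableSet_setOf_mem_passageSet (m : ℕ) :
    MeasurableSet {p : ℝ × (ℕ → ℝ) | p.2 ∈ passageSet m p.1} := by
  simp only [passageSet, Set.mem_ofPred_eq]
  measurability

lemma measurableSet_passageSet (m : ℕ) (x : ℝ) : MeasurableSet (passageSet m x) :=
  measurable_prodMk_left (measurableSet_setOf_mem_passageSet m)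

lemma cons_mem_passageSet_zero (x u : ℝ) (t : ℕ → ℝ) : cons u t ∈ passageSet 0 x ↔ x ≤ u := by
  simp [passageSet, sourceArrival_zero]

lemma cons_mem_passageSet_succ (m : ℕ) (x u : ℝ) (t : ℕ → ℝ) :
    cons u t ∈ passageSet (m + 1) x ↔ u < x ∧ t ∈ passageSet m (x - u) := by
  simp only [passageSet, Set.mem_ofPred_eq, Nat.forall_lt_succ_left, sourceArrival_cons_zero,
    sourceArrival_cons_succ, and_assoc, lt_sub_iff_add_lt', sub_le_iff_le_add']

lemma restart_zero_cons (x u : ℝ) (t : ℕ → ℝ) : restart 0 x (cons u t) = cons (u - x) t := by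
  simp only [restart, sourceArrival_cons_zero, zero_add, add_comm 1, cons_succ]

lemma restart_succ_cons (m : ℕ) (x u : ℝ) (t : ℕ → ℝ) :
    restart (m + 1) x (cons u t) = restart m (x - u) t := by
  simp only [restart, sourceArrival_cons_succ, add_right_comm _ 1, cons_succ]
  congr 1
  ring

lemma iidLaw_apply_eq_lintegral (ρ : Measure ℝ) [IsProbabilityMeasure ρ] {S : Set (ℕ → ℝ)}
    (hS : MeasurableSet S) : iidLaw ρ S = ∫⁻ u, iidLaw ρ {t | cons u t ∈ S} ∂ρ := by
  rw [← (measurePreserving_cons ρ).measure_preimage hS.nullMeasurableSet,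
    Measure.prod_apply (measurable_cons hS)]
  rfl

lemma measurableSet_passageSet_inter_restart (m : ℕ) (x : ℝ) {A : Set (ℕ → ℝ)}
    (hA : MeasurableSet A) : MeasurableSet (passageSet m x ∩ restart m x ⁻¹' A) :=
  (measurableSet_passageSet m x).inter (((measurable_restart m).comp measurable_prodMk_left) hA)

section

variable (r : ℝ) [Fact (0 < r)] {x : ℝ} {A : Set (ℕ → ℝ)}

lemma iidLaw_passageSet_zero_inter_restart (hx : 0 ≤ x) (hA : MeasurableSet A) :
    iidLaw (expMeasure r) (passageSet 0 x ∩ restart 0 x ⁻¹' A) =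
      ENNReal.ofReal (Real.exp (-(r * x))) * iidLaw (expMeasure r) A := by
  rw [iidLaw_apply_eq_lintegral _ (measurableSet_passageSet_inter_restart 0 x hA),
    iidLaw_apply_eq_lintegral _ hA,
    ← setLIntegral_Ici_comp_sub_expMeasure r hx
      (f := fun u => iidLaw (expMeasure r) {t | cons u t ∈ A})
      (measurable_measure_prodMk_left (measurable_cons hA)),
    ← lintegral_indicator measurableSet_Ici]
  refine lintegral_congr fun u => ?_
  by_cases hu : x ≤ u <;> simp [cons_mem_passageSet_zero, restart_zero_cons, hu]

lemma iidLaw_passageSet_inter_restart (m : ℕ) (hx : 0 ≤ x) (hA : MeasurableSet A) :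
    iidLaw (expMeasure r) (passageSet m x ∩ restart m x ⁻¹' A) =
      iidLaw (expMeasure r) (passageSet m x) * iidLaw (expMeasure r) A := by
  induction m generalizing x with
  | zero =>
    have hzero := iidLaw_passageSet_zero_inter_restart r hx MeasurableSet.univ
    simp only [Set.preimage_univ, Set.inter_univ, measure_univ, mul_one] at hzero
    rw [iidLaw_passageSet_zero_inter_restart r hx hA, hzero]
  | succ m ih =>
    rw [iidLaw_apply_eq_lintegral _ (measurableSet_passageSet_inter_restart (m + 1) x hA),
      iidLaw_apply_eq_lintegral _ (measurableSet_passageSet (m + 1) x),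
      ← lintegral_mul_const' _ _ (measure_ne_top _ _)]
    refine lintegral_congr fun u => ?_
    simp only [Set.mem_inter_iff, cons_mem_passageSet_succ, Set.mem_preimage, restart_succ_cons]
    by_cases hu : u < x
    · simp only [hu, true_and]
      exact ih (sub_nonneg.2 hu.le)
    · simp [hu]

end

/-- Index of the first arrival of the stream `z` that is not before `x`, and `0` if there is
none. -/
noncomputable def passageIndex (x : ℝ) (z : ℕ → ℝ) : ℕ := sInf {n | x ≤ sourceArrival z n}

lemma passageIndex_eq_of_mem {x : ℝ} {z : ℕ → ℝ} {m : ℕ} (h : z ∈ passageSet m x) :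
    passageIndex x z = m :=
  IsLeast.csInf_eq ⟨h.2, fun n hn => not_lt.1 fun hlt => (h.1 n hlt).not_ge hn⟩

lemma mem_passageSet_passageIndex {x : ℝ} {z : ℕ → ℝ} (h : ∃ n, x ≤ sourceArrival z n) :
    z ∈ passageSet (passageIndex x z) x :=
  ⟨fun _ hi => not_le.1 fun hle => Nat.notMem_of_lt_sInf hi hle, Nat.sInf_mem h⟩

lemma pairwise_disjoint_passageSet (x : ℝ) :
    Pairwise (Function.onFun Disjoint fun m => passageSet m x) := fun _ _ hmn =>
  Set.disjoint_left.2 fun _ hm hn =>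
    hmn ((passageIndex_eq_of_mem hm).symm.trans (passageIndex_eq_of_mem hn))

lemma passageIndex_eq_iff {x : ℝ} {z : ℕ → ℝ} {m : ℕ} :
    passageIndex x z = m ↔ z ∈ passageSet m x ∨ m = 0 ∧ ∀ n, sourceArrival z n < x := by
  constructor
  · rintro rfl
    by_cases h : ∃ n, x ≤ sourceArrival z n
    · exact .inl (mem_passageSet_passageIndex h)
    · push Not at h
      exact .inr ⟨by simp [passageIndex, (h _).not_ge], h⟩
  · rintro (h | ⟨rfl, h⟩)
    · exact passageIndex_eq_of_mem h
    · simp [passageIndex, (h _).not_ge]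

lemma measurable_passageIndex :
    Measurable fun p : ℝ × (ℕ → ℝ) => passageIndex p.1 p.2 := by
  have hnone : MeasurableSet {p : ℝ × (ℕ → ℝ) | ∀ n, sourceArrival p.2 n < p.1} := by
    measurability
  refine measurable_to_countable' fun m => ?_
  simp only [Set.preimage, Set.mem_singleton_iff, passageIndex_eq_iff]
  exact (measurableSet_setOf_mem_passageSet m).union (.inter (.const _) hnone)

/-- The stream `z` seen from time `x`: the time from `x` to the next arrival, followed by the later
gaps. -/
noncomputable def residual (x : ℝ) (z : ℕ → ℝ) : ℕ → ℝ := restart (passageIndex x z) x z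

lemma measurable_residual : Measurable (Function.uncurry residual) := by
  have h : Measurable fun q : (ℝ × (ℕ → ℝ)) × ℕ => restart q.2 q.1.1 q.1.2 :=
    measurable_from_prod_countable_left measurable_restart
  exact h.comp (measurable_id.prodMk measurable_passageIndex)

lemma tsum_measure_passageSet_inter {ν : Measure (ℕ → ℝ)}
    (hν : ∀ᵐ z ∂ν, Tendsto (sourceArrival z) atTop atTop) (x : ℝ) {S : Set (ℕ → ℝ)}
    (hS : MeasurableSet S) : ∑' m, ν (passageSet m x ∩ S) = ν S := by
  rw [← measure_iUnion (fun m n hmn => (pairwise_disjoint_passageSet x hmn).mono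
    Set.inter_subset_left Set.inter_subset_left)
    fun m => (measurableSet_passageSet m x).inter hS, ← Set.iUnion_inter]
  refine measure_congr ?_
  filter_upwards [hν] with z hz
  have hpassage : z ∈ ⋃ m, passageSet m x := Set.mem_iUnion.2
    ⟨_, mem_passageSet_passageIndex (hz.eventually (eventually_ge_atTop x)).exists⟩
  exact propext (and_iff_right hpassage)

lemma measurePreserving_residual (r : ℝ) [Fact (0 < r)] {x : ℝ} (hx : 0 ≤ x) :
    MeasurePreserving (residual x) (iidLaw (expMeasure r)) (iidLaw (expMeasure r)) := by
  set ν := iidLaw (expMeasure r)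
  have hres : Measurable (residual x) := measurable_residual.of_uncurry_left
  have hν : ∀ᵐ z ∂ν, Tendsto (sourceArrival z) atTop atTop :=
    ae_tendsto_sourceArrival (integrable_id_expMeasure r) (integral_id_expMeasure_pos r)
  refine ⟨hres, Measure.ext fun A hA => ?_⟩
  have hrestart : ∀ m, passageSet m x ∩ residual x ⁻¹' A = passageSet m x ∩ restart m x ⁻¹' A :=
    fun m => Set.ext fun z => and_congr_right fun hz => by
      rw [Set.mem_preimage, residual, passageIndex_eq_of_mem hz, Set.mem_preimage]
  calc ν.map (residual x) A = ∑' m, ν (passageSet m x ∩ residual x ⁻¹' A) := by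
        rw [Measure.map_apply hres hA, tsum_measure_passageSet_inter hν x (hres hA)]
    _ = ∑' m, ν (passageSet m x ∩ Set.univ) * ν A := by
        simp only [hrestart, Set.inter_univ]
        exact tsum_congr fun m => iidLaw_passageSet_inter_restart r m hx hA
    _ = ν A := by
        rw [ENNReal.tsum_mul_right, tsum_measure_passageSet_inter hν x .univ, measure_univ, one_mul]

/-! ### Idle periods -/

/-- `idle x z k` is the length of the idle period after the `k`-th service, when the services have
durations `x` and `z` are the gaps of the arrivals from the beginning of the first service on. -/
noncomputable def idle (x z : ℕ → ℝ) : ℕ → ℝ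
  | 0 => residual (x 0) z 0
  | k + 1 => idle (tail x) (tail (residual (x 0) z)) k

/-- The first `n` idle periods, followed by the gaps of the arrivals after the last of them.  Unlike
the idle periods alone, this sequence determines its successor, and it has the same law for all
`n`. -/
noncomputable def idleThenGaps : ℕ → (ℕ → ℝ) → (ℕ → ℝ) → ℕ → ℝ
  | 0, _, z => z
  | n + 1, x, z => cons (residual (x 0) z 0) (idleThenGaps n (tail x) (tail (residual (x 0) z)))

lemma idleThenGaps_apply_of_lt {n k : ℕ} (h : k < n) (x z : ℕ → ℝ) :
    idleThenGaps n x z k = idle x z k := by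
  induction n generalizing k x z with
  | zero => omega
  | succ n ih =>
    cases k with
    | zero => rfl
    | succ k => exact ih (by omega) _ _

lemma measurePreserving_idleThenGaps (r : ℝ) [Fact (0 < r)] (n : ℕ) {x : ℕ → ℝ}
    (hx : ∀ k, 0 ≤ x k) :
    MeasurePreserving (idleThenGaps n x) (iidLaw (expMeasure r)) (iidLaw (expMeasure r)) := by
  induction n generalizing x with
  | zero => exact .id _
  | succ n ih =>
    exact (measurePreserving_cons _).comp
      (((MeasurePreserving.id _).prod (ih (x := tail x) fun k => hx (k + 1))).comp
        ((measurePreserving_headTail _).comp (measurePreserving_residual r (hx 0))))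

lemma measurable_idle : Measurable (Function.uncurry idle) := by
  suffices h : ∀ k, Measurable fun p : (ℕ → ℝ) × (ℕ → ℝ) => idle p.1 p.2 k from
    measurable_pi_iff.2 h
  intro k
  have hres : Measurable fun p : (ℕ → ℝ) × (ℕ → ℝ) => residual (p.1 0) p.2 :=
    measurable_residual.comp (f := fun p : (ℕ → ℝ) × (ℕ → ℝ) => (p.1 0, p.2)) (by fun_prop)
  induction k with
  | zero => exact (measurable_pi_apply 0).comp hres
  | succ k ih =>
    exact ih.comp ((measurable_tail.comp measurable_fst).prodMk (measurable_tail.comp hres))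

lemma measurePreserving_idle (r : ℝ) [Fact (0 < r)] {x : ℕ → ℝ} (hx : ∀ k, 0 ≤ x k) :
    MeasurePreserving (idle x) (iidLaw (expMeasure r)) (iidLaw (expMeasure r)) := by
  have hidle : Measurable (idle x) := measurable_idle.of_uncurry_left
  refine ⟨hidle, Measure.eq_infinitePi _ fun s t ht => ?_⟩
  have hbox : MeasurableSet (Set.pi (s : Set ℕ) t) :=
    .pi (Finset.countable_toSet _) fun i _ => ht i
  have hfinite : idle x ⁻¹' Set.pi (s : Set ℕ) t =
      idleThenGaps (s.sup id + 1) x ⁻¹' Set.pi (s : Set ℕ) t := by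
    ext z
    refine forall₂_congr fun i hi => ?_
    have hi' : i < s.sup id + 1 := Nat.lt_succ_of_le (Finset.le_sup (f := id) hi)
    rw [idleThenGaps_apply_of_lt hi']
  rw [Measure.map_apply hidle hbox, hfinite,
    (measurePreserving_idleThenGaps r _ hx).measure_preimage hbox.nullMeasurableSet,
    Measure.infinitePi_pi _ fun i _ => ht i]

section

variable {Ω : Type*} [MeasurableSpace Ω]

/-- The idle period after the `k`-th service, as a random variable. -/
noncomputable def idlePeriod (Z X : ℕ → Ω → ℝ) (k : ℕ) (ω : Ω) : ℝ :=
  idle (fun n => X n ω) (tail fun n => Z n ω) k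

namespace IsMM11

variable {P : Measure Ω} {Z X : ℕ → Ω → ℝ} {lam mu : ℝ}

lemma measurable_input (h : IsMM11 P Z X lam mu) (i : ℕ ⊕ ℕ) :
    Measurable ((Sum.elim Z X : ℕ ⊕ ℕ → Ω → ℝ) i) :=
  Sum.rec h.measurable_interarrival h.measurable_service i

lemma measurable_idlePeriod (h : IsMM11 P Z X lam mu) (k : ℕ) :
    Measurable (idlePeriod Z X k) := by
  have hX := measurable_pi_iff.2 h.measurable_service
  have hZ := measurable_pi_iff.2 h.measurable_interarrival
  exact (measurable_pi_apply k).comp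
    (measurable_idle.comp (hX.prodMk (measurable_tail.comp hZ)))

lemma measurable_idlePeriod_service (h : IsMM11 P Z X lam mu) (i : ℕ ⊕ ℕ) :
    Measurable ((Sum.elim (idlePeriod Z X) X : ℕ ⊕ ℕ → Ω → ℝ) i) :=
  Sum.rec h.measurable_idlePeriod h.measurable_service i

lemma measurePreserving_interarrival (h : IsMM11 P Z X lam mu) :
    MeasurePreserving (fun ω n => Z n ω) P (iidLaw (expMeasure lam)) :=
  have hZ : Measurable fun ω n => Z n ω := measurable_pi_iff.2 h.measurable_interarrival
  ⟨hZ, ((h.indep.precomp Sum.inl_injective).hasLaw_infinitePi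
    (fun n => ⟨(h.measurable_interarrival n).aemeasurable, h.map_interarrival n⟩)
    hZ.aemeasurable).map_eq⟩

lemma measurePreserving_service (h : IsMM11 P Z X lam mu) :
    MeasurePreserving (fun ω n => X n ω) P (iidLaw (expMeasure mu)) :=
  have hX : Measurable fun ω n => X n ω := measurable_pi_iff.2 h.measurable_service
  ⟨hX, ((h.indep.precomp Sum.inr_injective).hasLaw_infinitePi
    (fun n => ⟨(h.measurable_service n).aemeasurable, h.map_service n⟩)
    hX.aemeasurable).map_eq⟩

lemma indepFun_interarrival_service (h : IsMM11 P Z X lam mu) :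
    IndepFun (fun ω n => Z n ω) (fun ω n => X n ω) P :=
  have := h.indep.isProbabilityMeasure
  indepFun_comp_of_disjoint_range h.measurable_input h.indep (f := Sum.inl) (g := Sum.inr)
    Set.isCompl_range_inl_range_inr.disjoint

variable [Fact (0 < mu)]

lemma ae_service_pos (h : IsMM11 P Z X lam mu) : ∀ᵐ ω ∂P, ∀ k, 0 < X k ω :=
  ae_all_iff.2 fun k => ae_of_ae_map (h.measurable_service k).aemeasurable
    ((h.map_service k).symm ▸ ae_pos_expMeasure mu)

variable [Fact (0 < lam)]

lemma measurePreserving_service_idlePeriod (h : IsMM11 P Z X lam mu) :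
    MeasurePreserving (fun ω => (fun n => X n ω, fun n => idlePeriod Z X n ω)) P
      ((iidLaw (expMeasure mu)).prod (iidLaw (expMeasure lam))) := by
  have hprob := h.indep.isProbabilityMeasure
  have hZ := (measurePreserving_tail _).comp h.measurePreserving_interarrival
  have hX := h.measurePreserving_service
  have hpair : MeasurePreserving (fun ω => (fun n => X n ω, tail fun n => Z n ω)) P
      ((iidLaw (expMeasure mu)).prod (iidLaw (expMeasure lam))) := by
    refine ⟨hX.measurable.prodMk hZ.measurable, ?_⟩
    have hind : IndepFun (fun ω n => X n ω) (tail ∘ fun ω n => Z n ω) P :=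
      h.indepFun_interarrival_service.symm.comp measurable_id measurable_tail
    exact (hind.map_prod_eq_prod_map_map hX.aemeasurable hZ.aemeasurable).trans
      (congr_arg₂ _ hX.map_eq hZ.map_eq)
  have hpos : ∀ᵐ x ∂(iidLaw (expMeasure mu)), ∀ k, 0 ≤ x k := ae_all_iff.2 fun k =>
    (measurePreserving_eval_infinitePi _ k).quasiMeasurePreserving.ae
      ((ae_pos_expMeasure mu).mono fun _ => le_of_lt)
  exact ((MeasurePreserving.id _).skew_product measurable_idle
    (hpos.mono fun x hx => (measurePreserving_idle lam hx).map_eq)).comp hpair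

lemma measurePreserving_idlePeriod (h : IsMM11 P Z X lam mu) :
    MeasurePreserving (fun ω n => idlePeriod Z X n ω) P (iidLaw (expMeasure lam)) :=
  measurePreserving_snd.comp h.measurePreserving_service_idlePeriod

lemma map_idlePeriod (h : IsMM11 P Z X lam mu) (k : ℕ) :
    P.map (idlePeriod Z X k) = expMeasure lam :=
  ((measurePreserving_eval_infinitePi _ k).comp h.measurePreserving_idlePeriod).map_eq

lemma iIndepFun_idlePeriod_service (h : IsMM11 P Z X lam mu) :
    iIndepFun (Sum.elim (idlePeriod Z X) X) P := by
  have hprob := h.indep.isProbabilityMeasure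
  have hI := h.measurePreserving_idlePeriod
  have hX := h.measurePreserving_service
  have hservice : iIndepFun X P := (h.indep.precomp Sum.inr_injective :)
  refine iIndepFun_sumElim ?_ hservice (IndepFun.symm ?_)
  · rw [iIndepFun_iff_hasLaw_Pi_infinitePi
      (fun k => ⟨(h.measurable_idlePeriod k).aemeasurable, h.map_idlePeriod k⟩) hI.aemeasurable]
    exact hI.hasLaw
  · rw [indepFun_iff_map_prod_eq_prod_map_map hX.aemeasurable hI.aemeasurable, hX.map_eq,
      hI.map_eq, h.measurePreserving_service_idlePeriod.map_eq]

end IsMM11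

end

/-! ### Sample paths -/

section Path

variable {z x : ℕ → ℝ}

/-- The gaps of the arrivals after the beginning of the `k`-th service. -/
noncomputable def gapsAfter (z x : ℕ → ℝ) (k : ℕ) : ℕ → ℝ := fun j => z (servedIndex z x k + 1 + j)

/-- Duration of the `k`-th cycle, from the departure of the packet `k` to that of the packet
`k + 1`: an idle period followed by a service. -/
noncomputable def cycleLength (z x : ℕ → ℝ) (k : ℕ) : ℝ := idle x (tail z) k + x (k + 1)

lemma sourceArrival_gapsAfter (z x : ℕ → ℝ) (k n : ℕ) :
    sourceArrival z (servedIndex z x k + 1 + n) =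
      arrivalTime z x k + sourceArrival (gapsAfter z x k) n :=
  sourceArrival_add z _ n

lemma arrivalTime_zero (z x : ℕ → ℝ) : arrivalTime z x 0 = z 0 := by
  rw [arrivalTime, servedIndex, sourceArrival_zero]

lemma exists_le_sourceArrival_gapsAfter (hS : Tendsto (sourceArrival z) atTop atTop)
    (k : ℕ) (c : ℝ) :
    ∃ n, c ≤ sourceArrival (gapsAfter z x k) n := by
  obtain ⟨n, hc, hn⟩ := ((hS.eventually_ge_atTop (arrivalTime z x k + c)).and
    (eventually_ge_atTop (servedIndex z x k + 1))).exists
  obtain ⟨j, rfl⟩ := Nat.exists_eq_add_of_le hn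
  rw [sourceArrival_gapsAfter] at hc
  exact ⟨j, by linarith⟩

lemma gapsAfter_mem_passageSet (hS : Tendsto (sourceArrival z) atTop atTop) (k : ℕ) :
    gapsAfter z x k ∈ passageSet (passageIndex (x k) (gapsAfter z x k)) (x k) :=
  mem_passageSet_passageIndex (exists_le_sourceArrival_gapsAfter hS k (x k))

lemma servedIndex_succ (hS : Tendsto (sourceArrival z) atTop atTop) (k : ℕ) :
    servedIndex z x (k + 1) =
      servedIndex z x k + 1 + passageIndex (x k) (gapsAfter z x k) := by
  refine IsLeast.csInf_eq ⟨⟨by omega, ?_⟩, fun n ⟨hlt, hle⟩ => ?_⟩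
  · rw [sourceArrival_gapsAfter]
    exact add_le_add_right (gapsAfter_mem_passageSet hS k).2 _
  · obtain ⟨j, rfl⟩ := Nat.exists_eq_add_of_le (Nat.succ_le_of_lt hlt)
    rw [Nat.succ_eq_add_one, sourceArrival_gapsAfter] at hle
    exact Nat.add_le_add_left (Nat.sInf_le (le_of_add_le_add_left (a := arrivalTime z x k) hle)) _

lemma gapsAfter_succ (hS : Tendsto (sourceArrival z) atTop atTop) (k : ℕ) :
    gapsAfter z x (k + 1) = tail (residual (x k) (gapsAfter z x k)) := by
  funext j
  rw [gapsAfter, servedIndex_succ hS, residual, restart, tail_cons, gapsAfter]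
  congr 1
  ring

lemma idle_gapsAfter (hS : Tendsto (sourceArrival z) atTop atTop) (m k : ℕ) :
    idle (fun j => x (m + j)) (gapsAfter z x m) k =
      residual (x (m + k)) (gapsAfter z x (m + k)) 0 := by
  induction k generalizing m with
  | zero => rfl
  | succ k ih =>
    have hshift : tail (fun j => x (m + j)) = fun j => x (m + 1 + j) :=
      funext fun j => congr_arg x (by ring)
    rw [idle, hshift, add_zero, ← gapsAfter_succ hS, ih, add_right_comm, add_assoc]

lemma idle_eq_residual (hS : Tendsto (sourceArrival z) atTop atTop) (k : ℕ) :
    idle x (tail z) k = residual (x k) (gapsAfter z x k) 0 := by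
  have hzero : gapsAfter z x 0 = tail z :=
    funext fun j => congr_arg z (by simp only [servedIndex]; ring)
  simpa only [zero_add, hzero] using idle_gapsAfter (x := x) hS 0 k

lemma arrivalTime_succ (hS : Tendsto (sourceArrival z) atTop atTop) (k : ℕ) :
    arrivalTime z x (k + 1) = departureTime z x k + idle x (tail z) k := by
  rw [arrivalTime, servedIndex_succ hS, sourceArrival_gapsAfter, departureTime,
    idle_eq_residual hS, residual, restart, cons_zero]
  ring

lemma departureTime_succ (hS : Tendsto (sourceArrival z) atTop atTop) (k : ℕ) :
    departureTime z x (k + 1) = departureTime z x k + cycleLength z x k := by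
  rw [departureTime, arrivalTime_succ hS, cycleLength, add_assoc]

lemma departureTime_eq_sum (hS : Tendsto (sourceArrival z) atTop atTop) (k : ℕ) :
    departureTime z x k = z 0 + x 0 + ∑ i ∈ Finset.range k, cycleLength z x i := by
  induction k with
  | zero => simp [departureTime, arrivalTime_zero]
  | succ k ih => rw [departureTime_succ hS, ih, Finset.sum_range_succ, add_assoc]

lemma idle_nonneg (hS : Tendsto (sourceArrival z) atTop atTop) (k : ℕ) :
    0 ≤ idle x (tail z) k := by
  rw [idle_eq_residual hS, residual, restart, cons_zero, sub_nonneg]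
  exact (gapsAfter_mem_passageSet hS k).2

lemma exists_mem_Ico_of_tendsto_atTop {α : Type*} [LinearOrder α] [NoMaxOrder α] {u : ℕ → α}
    (hu : Tendsto u atTop atTop) {t : α} (ht : u 0 ≤ t) : ∃ n, t ∈ Set.Ico (u n) (u (n + 1)) := by
  by_contra! hnone
  have hle : ∀ n, u n ≤ t := fun n => by
    induction n with
    | zero => exact ht
    | succ n ih => exact not_lt.1 fun hlt => hnone n ⟨ih, hlt⟩
  obtain ⟨n, hn⟩ := (hu.eventually_gt_atTop t).exists
  exact (hle n).not_gt hn

/-- The inputs without accidents: positive times and arrivals that do not accumulate. -/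
structure IsRegular (z x : ℕ → ℝ) : Prop where
  tendsto_sourceArrival : Tendsto (sourceArrival z) atTop atTop
  interarrival_pos : 0 < z 0
  service_pos : ∀ k, 0 < x k

namespace IsRegular

lemma cycleLength_pos (h : IsRegular z x) (k : ℕ) : 0 < cycleLength z x k :=
  add_pos_of_nonneg_of_pos (idle_nonneg h.tendsto_sourceArrival k) (h.service_pos _)

lemma strictMono_departureTime (h : IsRegular z x) : StrictMono (departureTime z x) :=
  strictMono_nat_of_lt_succ fun k => by
    rw [departureTime_succ h.tendsto_sourceArrival]
    exact lt_add_of_pos_right _ (h.cycleLength_pos k)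

lemma monotone_arrivalTime (h : IsRegular z x) : Monotone (arrivalTime z x) :=
  monotone_nat_of_le_succ fun k => by
    rw [arrivalTime_succ h.tendsto_sourceArrival, departureTime]
    linarith [idle_nonneg (x := x) h.tendsto_sourceArrival k, h.service_pos k]

lemma arrivalTime_pos (h : IsRegular z x) (k : ℕ) : 0 < arrivalTime z x k :=
  h.interarrival_pos.trans_le
    ((arrivalTime_zero z x).symm.trans_le (h.monotone_arrivalTime k.zero_le))

lemma departureTime_pos (h : IsRegular z x) (k : ℕ) : 0 < departureTime z x k :=
  add_pos (h.arrivalTime_pos k) (h.service_pos k)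

lemma age_of_mem_Ico (h : IsRegular z x) {t : ℝ} {k : ℕ}
    (ht : t ∈ Set.Ico (departureTime z x k) (departureTime z x (k + 1))) :
    age z x t = x k + (t - departureTime z x k) := by
  have hlatest : IsGreatest {a | ∃ n, departureTime z x n ≤ t ∧ arrivalTime z x n = a}
      (arrivalTime z x k) := by
    refine ⟨⟨k, ht.1, rfl⟩, ?_⟩
    rintro a ⟨n, hn, rfl⟩
    exact h.monotone_arrivalTime
      (Nat.le_of_lt_succ (h.strictMono_departureTime.lt_iff_lt.1 (hn.trans_lt ht.2)))
  rw [age, hlatest.csSup_eq, departureTime]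
  ring

lemma age_of_lt (h : IsRegular z x) {t : ℝ} (ht : t < departureTime z x 0) : age z x t = t := by
  have hempty : {a | ∃ n, departureTime z x n ≤ t ∧ arrivalTime z x n = a} = ∅ :=
    Set.eq_empty_of_forall_notMem fun a ⟨n, hn, _⟩ =>
      (hn.trans_lt ht).not_ge (h.strictMono_departureTime.monotone n.zero_le)
  rw [age, hempty, Real.sSup_empty, sub_zero]

lemma tendsto_departureTime (h : IsRegular z x) : Tendsto (departureTime z x) atTop atTop := by
  have hindex : StrictMono (servedIndex z x) := strictMono_nat_of_lt_succ fun k => by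
    rw [servedIndex_succ h.tendsto_sourceArrival]
    omega
  exact tendsto_atTop_mono (fun k => le_add_of_nonneg_right (h.service_pos k).le)
    (h.tendsto_sourceArrival.comp hindex.tendsto_atTop)

lemma lt_age_iff (h : IsRegular z x) {d t : ℝ} :
    d < age z x t ↔ d < t ∧ ∀ n, departureTime z x n ≤ t → departureTime z x n + d < x n + t := by
  rcases lt_or_ge t (departureTime z x 0) with ht | ht
  · rw [h.age_of_lt ht, iff_self_and]
    exact fun _ n hn =>
      absurd (h.strictMono_departureTime.monotone n.zero_le) (hn.trans_lt ht).not_ge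
  · obtain ⟨k, hk⟩ := exists_mem_Ico_of_tendsto_atTop h.tendsto_departureTime ht
    rw [h.age_of_mem_Ico hk]
    constructor
    · refine fun hd => ⟨?_, fun n hn => ?_⟩
      · have := h.arrivalTime_pos k
        rw [departureTime] at hd
        linarith
      · have := h.monotone_arrivalTime (Nat.le_of_lt_succ
          (h.strictMono_departureTime.lt_iff_lt.1 (hn.trans_lt hk.2)))
        simp only [departureTime] at hd ⊢
        linarith
    · rintro ⟨-, hd⟩
      linarith [hd k hk.1]

lemma exceedanceTime_succ (h : IsRegular z x) (d : ℝ) (k : ℕ) :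
    exceedanceTime z x d (k + 1) = max 0 (cycleLength z x k - max 0 (d - x k)) := by
  set D := departureTime z x k
  have hD : departureTime z x (k + 1) = D + cycleLength z x k :=
    departureTime_succ h.tendsto_sourceArrival k
  have hset : {t | t ∈ Set.Ico D (departureTime z x (k + 1)) ∧ d < age z x t} =
      Set.Ico D (D + cycleLength z x k) ∩ Set.Ioi (D + (d - x k)) := by
    rw [← hD]
    refine Set.ext fun t => and_congr_right fun ht => ?_
    rw [h.age_of_mem_Ico ht, Set.mem_Ioi, ← sub_lt_iff_lt_add', lt_sub_iff_add_lt']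
  have hae : (Set.Ico D (D + cycleLength z x k) ∩ Set.Ioi (D + (d - x k)) : Set ℝ) =ᵐ[volume]
      Set.Ioo (D + max 0 (d - x k)) (D + cycleLength z x k) := by
    rw [← max_add_add_left, add_zero, ← Set.Ioo_inter_Ioi]
    exact Ioo_ae_eq_Ico.symm.inter (ae_eq_refl _)
  rw [exceedanceTime, Nat.add_sub_cancel, hset, Measure.real, measure_congr hae, Real.volume_Ioo,
    add_sub_add_left_eq_sub, ENNReal.toReal_ofReal', max_comm]

end IsRegular

end Path

/-! ### The mean exceedance of a cycle -/

section

lemma hasDerivAt_exp_neg_mul (c t : ℝ) :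
    HasDerivAt (fun t => Real.exp (-(c * t))) (-(c * Real.exp (-(c * t)))) t := by
  simpa [mul_comm] using ((hasDerivAt_id t).const_mul (-c)).exp

lemma tendsto_exp_neg_mul_atTop {c : ℝ} (hc : 0 < c) :
    Tendsto (fun t => Real.exp (-(c * t))) atTop (𝓝 0) :=
  Real.tendsto_exp_neg_atTop_nhds_zero.comp (tendsto_id.const_mul_atTop hc)

lemma exp_sub_mul (a b t : ℝ) :
    Real.exp ((b - a) * t) = Real.exp (-(a * t)) * Real.exp (b * t) := by
  rw [← Real.exp_add]
  congr 1
  ring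

lemma integral_exp_mul {c : ℝ} (hc : c ≠ 0) (s : ℝ) :
    ∫ t in (0 : ℝ)..s, Real.exp (c * t) = (Real.exp (c * s) - 1) / c := by
  rw [intervalIntegral.integral_comp_mul_left (fun t => Real.exp t) hc, integral_exp, mul_zero,
    Real.exp_zero, smul_eq_mul, inv_mul_eq_div]

lemma integral_Ioi_mul_exp_neg_mul_max {h : ℝ → ℝ} (hh : IntegrableOn h (Set.Ioi 0)) {r s : ℝ}
    (hr : 0 ≤ r) (hs : 0 ≤ s) :
    IntegrableOn (fun t => h t * Real.exp (-(r * max (s - t) 0))) (Set.Ioi 0) ∧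
      ∫ t in Set.Ioi 0, h t * Real.exp (-(r * max (s - t) 0)) =
        Real.exp (-(r * s)) * (∫ t in (0 : ℝ)..s, h t * Real.exp (r * t)) +
          ∫ t in Set.Ioi s, h t := by
  have hint : IntegrableOn (fun t => h t * Real.exp (-(r * max (s - t) 0))) (Set.Ioi 0) := by
    refine hh.mul_bdd (c := 1) (by fun_prop) (Eventually.of_forall fun t => ?_)
    rw [Real.norm_of_nonneg (Real.exp_pos _).le, Real.exp_le_one_iff, neg_nonpos]
    exact mul_nonneg hr (le_max_right _ _)
  refine ⟨hint, ?_⟩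
  rw [← intervalIntegral.integral_interval_add_Ioi hint (hint.mono_set (Set.Ioi_subset_Ioi hs)),
    ← intervalIntegral.integral_const_mul]
  congr 1
  · refine intervalIntegral.integral_congr fun t ht => ?_
    rw [Set.uIcc_of_le hs] at ht
    rw [max_eq_left (sub_nonneg.2 ht.2), mul_left_comm, ← Real.exp_add]
    congr 2
    ring
  · refine setIntegral_congr_fun measurableSet_Ioi fun t ht => ?_
    rw [max_eq_right (sub_nonpos.2 (le_of_lt ht)), mul_zero, neg_zero, Real.exp_zero, mul_one]

lemma lintegral_Ioi_mul_expMeasure_Ioi_sub {h : ℝ → ℝ} (hh : IntegrableOn h (Set.Ioi 0))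
    (hnonneg : ∀ t ∈ Set.Ioi (0 : ℝ), 0 ≤ h t) (r : ℝ) [hr : Fact (0 < r)] {s : ℝ} (hs : 0 ≤ s) :
    ∫⁻ t in Set.Ioi 0, ENNReal.ofReal (h t) * expMeasure r (Set.Ioi (s - t)) =
      ENNReal.ofReal (Real.exp (-(r * s)) * (∫ t in (0 : ℝ)..s, h t * Real.exp (r * t)) +
        ∫ t in Set.Ioi s, h t) := by
  obtain ⟨hint, hvalue⟩ := integral_Ioi_mul_exp_neg_mul_max hh hr.out.le hs
  have hnonneg' : ∀ᵐ t ∂(volume.restrict (Set.Ioi 0)),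
      0 ≤ h t * Real.exp (-(r * max (s - t) 0)) :=
    (ae_restrict_mem measurableSet_Ioi).mono fun t ht =>
      mul_nonneg (hnonneg t ht) (Real.exp_pos _).le
  rw [← hvalue, ofReal_integral_eq_lintegral_ofReal hint hnonneg']
  refine setLIntegral_congr_fun measurableSet_Ioi fun t ht => ?_
  rw [expMeasure_Ioi_eq_exp_max, ENNReal.ofReal_mul (hnonneg t ht)]

/-- Tail `s ↦ P(I + X > s)`, for `s ≥ 0`, of the hypoexponential law, that is, of the sum of
independent exponential variables with rates `lam` and `mu`. -/
noncomputable def hypoexpTail (lam mu s : ℝ) : ℝ :=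
  if lam = mu then (1 + mu * s) * Real.exp (-(mu * s))
  else (mu * Real.exp (-(lam * s)) - lam * Real.exp (-(mu * s))) / (mu - lam)

/-- Mean excess `E[(I + X - s)⁺]` of the hypoexponential law over a level `s ≥ 0`: the integral of
its tail from `s` on. -/
noncomputable def hypoexpExcess (lam mu s : ℝ) : ℝ :=
  if lam = mu then (2 / mu + s) * Real.exp (-(mu * s))
  else (mu / lam * Real.exp (-(lam * s)) - lam / mu * Real.exp (-(mu * s))) / (mu - lam)

/-- Mean exceedance time of the level `d` during one cycle: the value of `E[g(k)]`. -/
noncomputable def meanExceedance (lam mu d : ℝ) : ℝ :=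
  if lam = mu then mu * Real.exp (-mu * d) / 2 * (d + 2 / mu) ^ 2
  else mu ^ 2 * (Real.exp (-lam * d) - Real.exp (-mu * d)) / (lam * (mu - lam) ^ 2) +
    Real.exp (-mu * d) * (1 / lam + 1 / mu - lam * d / (mu - lam))

variable {lam mu : ℝ}

lemma integral_Ioi_mul_exp_neg_mul (hlam : 0 < lam) (s : ℝ) :
    ∫ t in Set.Ioi s, lam * Real.exp (-(lam * t)) = Real.exp (-(lam * s)) := by
  have h := integral_exp_mul_Ioi (neg_neg_of_pos hlam) s
  simp only [neg_mul] at h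
  rw [integral_const_mul, h]
  field_simp

lemma hypoexpTail_eq_integral (hlam : 0 < lam) (s : ℝ) :
    Real.exp (-(mu * s)) *
        (∫ t in (0 : ℝ)..s, lam * Real.exp (-(lam * t)) * Real.exp (mu * t)) +
      ∫ t in Set.Ioi s, lam * Real.exp (-(lam * t)) = hypoexpTail lam mu s := by
  simp only [mul_assoc, ← exp_sub_mul]
  rw [intervalIntegral.integral_const_mul, integral_Ioi_mul_exp_neg_mul hlam]
  rcases eq_or_ne lam mu with rfl | hne
  · simp only [sub_self, zero_mul, Real.exp_zero, intervalIntegral.integral_const, hypoexpTail,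
      if_true, sub_zero, smul_eq_mul]
    ring
  · have hsub : mu - lam ≠ 0 := sub_ne_zero.2 hne.symm
    have hcancel : Real.exp (-(mu * s)) * Real.exp (mu * s) = 1 := by
      rw [← Real.exp_add, neg_add_cancel, Real.exp_zero]
    rw [integral_exp_mul hsub, hypoexpTail, if_neg hne, exp_sub_mul]
    generalize Real.exp (-(lam * s)) = a, Real.exp (-(mu * s)) = b, Real.exp (mu * s) = c
      at hcancel ⊢
    field_simp
    linear_combination lam * a * hcancel

lemma hypoexpTail_nonneg (hlam : 0 < lam) {s : ℝ} (hs : 0 ≤ s) : 0 ≤ hypoexpTail lam mu s := by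
  have hpdf : ∀ t, 0 ≤ lam * Real.exp (-(lam * t)) := fun t =>
    mul_nonneg hlam.le (Real.exp_pos _).le
  rw [← hypoexpTail_eq_integral hlam]
  exact add_nonneg (mul_nonneg (Real.exp_pos _).le (intervalIntegral.integral_nonneg hs
    fun t _ => mul_nonneg (hpdf t) (Real.exp_pos _).le)) (integral_nonneg hpdf)

lemma hasDerivAt_hypoexpExcess (hlam : lam ≠ 0) (hmu : mu ≠ 0) (s : ℝ) :
    HasDerivAt (fun s => -hypoexpExcess lam mu s) (hypoexpTail lam mu s) s := by
  unfold hypoexpExcess hypoexpTail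
  split_ifs with h
  · refine (((hasDerivAt_id s).const_add (2 / mu)).mul
      (hasDerivAt_exp_neg_mul mu s)).neg.congr_deriv ?_
    simp only [id]
    field_simp
    ring
  · refine ((((hasDerivAt_exp_neg_mul lam s).const_mul (mu / lam)).sub
      ((hasDerivAt_exp_neg_mul mu s).const_mul (lam / mu))).div_const
        (mu - lam)).neg.congr_deriv ?_
    field_simp
    ring

lemma tendsto_hypoexpExcess_atTop (hlam : 0 < lam) (hmu : 0 < mu) :
    Tendsto (fun s => hypoexpExcess lam mu s) atTop (𝓝 0) := by
  have hmuexp := tendsto_exp_neg_mul_atTop hmu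
  unfold hypoexpExcess
  split_ifs with h
  · have hmul : Tendsto (fun s : ℝ => s * Real.exp (-(mu * s))) atTop (𝓝 0) := by
      simpa using tendsto_rpow_mul_exp_neg_mul_atTop_nhds_zero 1 mu hmu
    simpa [add_mul] using (hmuexp.const_mul (2 / mu)).add hmul
  · simpa using (((tendsto_exp_neg_mul_atTop hlam).const_mul (mu / lam)).sub
      (hmuexp.const_mul (lam / mu))).div_const (mu - lam)

lemma integrableOn_hypoexpTail (hlam : 0 < lam) (hmu : 0 < mu) {s : ℝ} (hs : 0 ≤ s) :
    IntegrableOn (hypoexpTail lam mu) (Set.Ioi s) :=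
  integrableOn_Ioi_deriv_of_nonneg' (fun t _ => hasDerivAt_hypoexpExcess hlam.ne' hmu.ne' t)
    (fun _ ht => hypoexpTail_nonneg hlam (hs.trans (le_of_lt ht)))
    (tendsto_hypoexpExcess_atTop hlam hmu).neg

lemma integral_Ioi_hypoexpTail (hlam : 0 < lam) (hmu : 0 < mu) {s : ℝ} (hs : 0 ≤ s) :
    ∫ t in Set.Ioi s, hypoexpTail lam mu t = hypoexpExcess lam mu s := by
  rw [integral_Ioi_of_hasDerivAt_of_tendsto'
    (fun t _ => hasDerivAt_hypoexpExcess hlam.ne' hmu.ne' t)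
    (integrableOn_hypoexpTail hlam hmu hs) (tendsto_hypoexpExcess_atTop hlam hmu).neg, neg_zero,
    sub_neg_eq_add, zero_add]

lemma integral_hypoexpTail_self_mul_exp (s : ℝ) :
    ∫ t in (0 : ℝ)..s, hypoexpTail mu mu t * Real.exp (mu * t) = s + mu * s ^ 2 / 2 := by
  have htail (t : ℝ) : hypoexpTail mu mu t * Real.exp (mu * t) = 1 + mu * t := by
    rw [hypoexpTail, if_pos rfl, mul_assoc, ← exp_sub_mul, sub_self, zero_mul, Real.exp_zero,
      mul_one]
  simp only [htail]
  rw [intervalIntegral.integral_add (by simp)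
    (Continuous.intervalIntegrable (by fun_prop) _ _), intervalIntegral.integral_const_mul,
    integral_id, intervalIntegral.integral_const, smul_eq_mul]
  ring

lemma integral_hypoexpTail_mul_exp_of_ne (h : lam ≠ mu) (s : ℝ) :
    ∫ t in (0 : ℝ)..s, hypoexpTail lam mu t * Real.exp (mu * t) =
      (mu * ((Real.exp ((mu - lam) * s) - 1) / (mu - lam)) - lam * s) / (mu - lam) := by
  have htail (t : ℝ) : hypoexpTail lam mu t * Real.exp (mu * t) =
      (mu * Real.exp ((mu - lam) * t) - lam) / (mu - lam) := by
    have hone : Real.exp (-(mu * t)) * Real.exp (mu * t) = 1 := by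
      rw [← exp_sub_mul, sub_self, zero_mul, Real.exp_zero]
    rw [hypoexpTail, if_neg h, div_mul_eq_mul_div, sub_mul, mul_assoc, mul_assoc, ← exp_sub_mul,
      hone, mul_one]
  simp only [htail]
  rw [intervalIntegral.integral_div,
    intervalIntegral.integral_sub (Continuous.intervalIntegrable (by fun_prop) _ _) (by simp),
    intervalIntegral.integral_const_mul, integral_exp_mul (sub_ne_zero.2 h.symm),
    intervalIntegral.integral_const, smul_eq_mul]
  ring

lemma meanExceedance_eq_integral_add_hypoexpExcess (hlam : lam ≠ 0) (hmu : mu ≠ 0) (d : ℝ) :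
    Real.exp (-(mu * d)) * (∫ t in (0 : ℝ)..d, hypoexpTail lam mu t * Real.exp (mu * t)) +
      hypoexpExcess lam mu d = meanExceedance lam mu d := by
  rcases eq_or_ne lam mu with rfl | hne
  · rw [integral_hypoexpTail_self_mul_exp, hypoexpExcess, meanExceedance, if_pos rfl, if_pos rfl,
      neg_mul]
    field_simp
    ring
  · have hsub : mu - lam ≠ 0 := sub_ne_zero.2 hne.symm
    have hcancel : Real.exp (-(mu * d)) * Real.exp (mu * d) = 1 := by
      rw [← Real.exp_add, neg_add_cancel, Real.exp_zero]
    rw [integral_hypoexpTail_mul_exp_of_ne hne, hypoexpExcess, meanExceedance, if_neg hne,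
      if_neg hne, neg_mul, neg_mul, exp_sub_mul]
    generalize Real.exp (-(lam * d)) = a, Real.exp (-(mu * d)) = b, Real.exp (mu * d) = c
      at hcancel ⊢
    field_simp
    linear_combination lam * mu ^ 2 * a * hcancel

lemma lintegral_Ioi_hypoexpTail_mul_expMeasure [hlam : Fact (0 < lam)] [hmu : Fact (0 < mu)]
    {d : ℝ} (hd : 0 ≤ d) :
    ∫⁻ s in Set.Ioi 0, ENNReal.ofReal (hypoexpTail lam mu s) * expMeasure mu (Set.Ioi (d - s)) =
      ENNReal.ofReal (meanExceedance lam mu d) := by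
  rw [lintegral_Ioi_mul_expMeasure_Ioi_sub (integrableOn_hypoexpTail hlam.out hmu.out le_rfl)
    (fun t ht => hypoexpTail_nonneg hlam.out (le_of_lt ht)) mu hd,
    integral_Ioi_hypoexpTail hlam.out hmu.out hd,
    meanExceedance_eq_integral_add_hypoexpExcess hlam.out.ne' hmu.out.ne']

lemma conv_expMeasure_Ioi [hlam : Fact (0 < lam)] [Fact (0 < mu)] {s : ℝ} (hs : 0 ≤ s) :
    (expMeasure lam ∗ expMeasure mu) (Set.Ioi s) = ENNReal.ofReal (hypoexpTail lam mu s) := by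
  have hadd : Measurable fun p : ℝ × ℝ => p.1 + p.2 := by fun_prop
  have htail : Measurable fun u => expMeasure mu (Set.Ioi (s - u)) := by
    simp only [expMeasure_Ioi_eq_exp_max]
    fun_prop
  have hslice : ∀ u : ℝ, Prod.mk u ⁻¹' ((fun p : ℝ × ℝ => p.1 + p.2) ⁻¹' Set.Ioi s) =
      Set.Ioi (s - u) := fun u => by
    ext v
    simp only [Set.mem_preimage, Set.mem_Ioi, sub_lt_iff_lt_add']
  rw [Measure.conv, Measure.map_apply hadd measurableSet_Ioi,
    Measure.prod_apply (hadd measurableSet_Ioi)]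
  simp only [hslice]
  rw [lintegral_expMeasure lam htail, lintegral_indicator measurableSet_Ici,
    setLIntegral_congr Ioi_ae_eq_Ici.symm,
    lintegral_Ioi_mul_expMeasure_Ioi_sub
      ((integrableOn_exp_neg_mul_Ioi hlam.out 0).const_mul lam)
      (fun t _ => mul_nonneg hlam.out.le (Real.exp_pos _).le) mu hs,
    hypoexpTail_eq_integral hlam.out]

end

/-! ### Cycles -/

lemma lintegral_prod_sub_max (ρ σ : Measure ℝ) [SFinite ρ] [SFinite σ] (d : ℝ) :
    ∫⁻ p, ENNReal.ofReal (p.2 - max 0 (d - p.1)) ∂(ρ.prod σ) =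
      ∫⁻ s in Set.Ioi 0, σ (Set.Ioi s) * ρ (Set.Ioi (d - s)) := by
  set S : Set ((ℝ × ℝ) × ℝ) := {q | max 0 (d - q.1.1) < q.2} ∩ {q | q.2 < q.1.2}
  have hS : MeasurableSet S :=
    (measurableSet_lt (by fun_prop) (by fun_prop)).inter
      (measurableSet_lt (by fun_prop) (by fun_prop))
  have hinner : ∀ p : ℝ × ℝ,
      volume (Prod.mk p ⁻¹' S) = ENNReal.ofReal (p.2 - max 0 (d - p.1)) := fun p => by
    rw [← Real.volume_Ioo]
    rfl
  have houter : ∀ s, (ρ.prod σ) ((fun p => (p, s)) ⁻¹' S) =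
      (Set.Ioi 0).indicator (fun s => σ (Set.Ioi s) * ρ (Set.Ioi (d - s))) s := fun s => by
    rcases lt_or_ge 0 s with hs | hs
    · have hslice : (fun p : ℝ × ℝ => (p, s)) ⁻¹' S = Set.Ioi (d - s) ×ˢ Set.Ioi s := by
        ext p
        simp [S, hs, sub_lt_comm]
      rw [hslice, Measure.prod_prod, Set.indicator_of_mem (Set.mem_Ioi.2 hs), mul_comm]
    · have hslice : (fun p : ℝ × ℝ => (p, s)) ⁻¹' S = ∅ := by
        ext p
        simp [S, hs.not_gt]
      rw [hslice, measure_empty, Set.indicator_of_notMem (Set.notMem_Ioi.2 hs)]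
  rw [← lintegral_indicator measurableSet_Ioi, ← lintegral_congr houter, ← lintegral_congr hinner,
    ← Measure.prod_apply hS, Measure.prod_apply_symm hS]

/-- The law of a cycle, encoded by the age at its start and its length.  The age at the start is the
previous service time; the length is the sum of an idle period and the next service time. -/
noncomputable def cycleLaw (lam mu : ℝ) : Measure (ℝ × ℝ) :=
  (expMeasure mu).prod (expMeasure lam ∗ expMeasure mu)

/-- Time for which the age exceeds `d` during the cycle `p = (age at the start, length)`. -/
noncomputable def exceedance (d : ℝ) (p : ℝ × ℝ) : ℝ := max 0 (p.2 - max 0 (d - p.1))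

lemma measurable_exceedance (d : ℝ) : Measurable (exceedance d) := by
  unfold exceedance
  fun_prop

lemma exceedance_nonneg (d : ℝ) (p : ℝ × ℝ) : 0 ≤ exceedance d p := le_max_left _ _

lemma meanExceedance_nonneg {lam mu d : ℝ} (hlam : 0 < lam) (hmu : 0 < mu) (hd : 0 ≤ d) :
    0 ≤ meanExceedance lam mu d := by
  rw [← meanExceedance_eq_integral_add_hypoexpExcess hlam.ne' hmu.ne',
    ← integral_Ioi_hypoexpTail hlam hmu hd]
  refine add_nonneg (mul_nonneg (Real.exp_pos _).le (intervalIntegral.integral_nonneg hd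
    fun t ht => mul_nonneg (hypoexpTail_nonneg hlam ht.1) (Real.exp_pos _).le)) ?_
  exact setIntegral_nonneg measurableSet_Ioi fun t ht =>
    hypoexpTail_nonneg hlam (hd.trans (le_of_lt ht))

section

variable {lam mu d : ℝ} [hlam : Fact (0 < lam)] [hmu : Fact (0 < mu)]

lemma lintegral_exceedance_cycleLaw (hd : 0 ≤ d) :
    ∫⁻ p, ENNReal.ofReal (exceedance d p) ∂(cycleLaw lam mu) =
      ENNReal.ofReal (meanExceedance lam mu d) := by
  simp only [exceedance, ENNReal.ofReal_max, ENNReal.ofReal_zero, zero_le, max_eq_right]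
  rw [cycleLaw, lintegral_prod_sub_max, ← lintegral_Ioi_hypoexpTail_mul_expMeasure hd]
  refine setLIntegral_congr_fun measurableSet_Ioi fun s hs => ?_
  rw [conv_expMeasure_Ioi (le_of_lt hs)]

lemma integrable_exceedance_cycleLaw (hd : 0 ≤ d) :
    Integrable (exceedance d) (cycleLaw lam mu) := by
  refine ⟨(measurable_exceedance d).aestronglyMeasurable, ?_⟩
  rw [hasFiniteIntegral_iff_ofReal (Eventually.of_forall (exceedance_nonneg d)),
    lintegral_exceedance_cycleLaw hd]
  exact ENNReal.ofReal_lt_top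

lemma integral_exceedance_cycleLaw (hd : 0 ≤ d) :
    ∫ p, exceedance d p ∂(cycleLaw lam mu) = meanExceedance lam mu d := by
  rw [integral_eq_lintegral_of_nonneg_ae (Eventually.of_forall (exceedance_nonneg d))
    (measurable_exceedance d).aestronglyMeasurable, lintegral_exceedance_cycleLaw hd,
    ENNReal.toReal_ofReal (meanExceedance_nonneg hlam.out hmu.out hd)]

end

section

variable {Ω : Type*} [MeasurableSpace Ω]

/-- The `k`-th cycle as a random variable: the age at its start and its length. -/
noncomputable def cycle (Z X : ℕ → Ω → ℝ) (k : ℕ) (ω : Ω) : ℝ × ℝ :=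
  (X k ω, idlePeriod Z X k ω + X (k + 1) ω)

namespace IsMM11

variable {P : Measure Ω} {Z X : ℕ → Ω → ℝ} {lam mu d : ℝ}

lemma measurable_cycle (h : IsMM11 P Z X lam mu) (k : ℕ) : Measurable (cycle Z X k) :=
  (h.measurable_service k).prodMk ((h.measurable_idlePeriod k).add (h.measurable_service (k + 1)))

variable [hlam : Fact (0 < lam)] [hmu : Fact (0 < mu)]

lemma map_cycle (h : IsMM11 P Z X lam mu) (k : ℕ) : P.map (cycle Z X k) = cycleLaw lam mu := by
  have := h.indep.isProbabilityMeasure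
  have hI := h.measurable_idlePeriod k
  have hX := h.measurable_service
  have hsum : IndepFun (idlePeriod Z X k) (X (k + 1)) P :=
    (h.iIndepFun_idlePeriod_service.indepFun (i := .inl k) (j := .inr (k + 1)) (by simp) :)
  have hpair : IndepFun (fun ω => (idlePeriod Z X k ω, X (k + 1) ω)) (X k) P :=
    (h.iIndepFun_idlePeriod_service.indepFun_prodMk h.measurable_idlePeriod_service
      (.inl k) (.inr (k + 1)) (.inr k) (by simp) (by simp) :)
  have hind : IndepFun (X k) (idlePeriod Z X k + X (k + 1)) P :=
    hpair.symm.comp measurable_id measurable_add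
  refine (hind.map_prod_eq_prod_map_map (hX k).aemeasurable
    (hI.add (hX (k + 1))).aemeasurable).trans ?_
  rw [hsum.map_add_eq_map_conv_map hI (hX (k + 1)), h.map_idlePeriod, h.map_service,
    h.map_service, cycleLaw]

lemma indepFun_cycle (h : IsMM11 P Z X lam mu) {i j : ℕ} (hij : i + 2 ≤ j) :
    IndepFun (cycle Z X i) (cycle Z X j) P := by
  have := h.indep.isProbabilityMeasure
  set index : ℕ → Fin 3 → ℕ ⊕ ℕ := fun k => ![.inr k, .inl k, .inr (k + 1)]
  have hdisjoint : Disjoint (Set.range (index i)) (Set.range (index j)) := by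
    rw [Set.disjoint_range_iff]
    intro a b
    fin_cases a <;> fin_cases b <;> simp [index] <;> omega
  have hcollect : Measurable fun v : Fin 3 → ℝ => (v 0, v 1 + v 2) := by fun_prop
  exact (indepFun_comp_of_disjoint_range h.measurable_idlePeriod_service
    h.iIndepFun_idlePeriod_service hdisjoint).comp hcollect hcollect

lemma ae_isRegular (h : IsMM11 P Z X lam mu) :
    ∀ᵐ ω ∂P, IsRegular (fun n => Z n ω) (fun n => X n ω) := by
  have harrival := h.measurePreserving_interarrival.quasiMeasurePreserving.ae
    (ae_tendsto_sourceArrival (integrable_id_expMeasure lam) (integral_id_expMeasure_pos lam))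
  have hZpos : ∀ᵐ ω ∂P, 0 < Z 0 ω := ae_of_ae_map (h.measurable_interarrival 0).aemeasurable
    ((h.map_interarrival 0).symm ▸ ae_pos_expMeasure lam)
  filter_upwards [harrival, hZpos, h.ae_service_pos] with ω htop hZ hX
  exact ⟨htop, hZ, hX⟩

lemma interDeparture_succ_ae_eq (h : IsMM11 P Z X lam mu) (k : ℕ) :
    interDeparture Z X (k + 1) =ᵐ[P] fun ω => (cycle Z X k ω).2 := by
  filter_upwards [h.ae_isRegular] with ω hω
  rw [interDeparture, Nat.add_sub_cancel, departureTime_succ hω.tendsto_sourceArrival,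
    add_sub_cancel_left]
  rfl

lemma g_succ_ae_eq (h : IsMM11 P Z X lam mu) (d : ℝ) (k : ℕ) :
    g Z X d (k + 1) =ᵐ[P] fun ω => exceedance d (cycle Z X k ω) := by
  filter_upwards [h.ae_isRegular] with ω hω
  exact hω.exceedanceTime_succ d k

lemma integrable_length_cycle (h : IsMM11 P Z X lam mu) (k : ℕ) :
    Integrable (fun ω => (cycle Z X k ω).2) P :=
  (integrable_of_map_eq_expMeasure (h.measurable_idlePeriod k) (h.map_idlePeriod k)).add
    (integrable_of_map_eq_expMeasure (h.measurable_service (k + 1)) (h.map_service (k + 1)))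

lemma integral_length_cycle (h : IsMM11 P Z X lam mu) (k : ℕ) :
    ∫ ω, (cycle Z X k ω).2 ∂P = 1 / lam + 1 / mu := by
  have hI := h.measurable_idlePeriod k
  have hX := h.measurable_service (k + 1)
  rw [← integral_of_map_eq_expMeasure hI (h.map_idlePeriod k),
    ← integral_of_map_eq_expMeasure hX (h.map_service (k + 1))]
  exact integral_add (integrable_of_map_eq_expMeasure hI (h.map_idlePeriod k))
    (integrable_of_map_eq_expMeasure hX (h.map_service (k + 1)))

lemma integrable_exceedance_cycle (h : IsMM11 P Z X lam mu) (hd : 0 ≤ d) (k : ℕ) :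
    Integrable (fun ω => exceedance d (cycle Z X k ω)) P :=
  (integrable_map_measure (measurable_exceedance d).aestronglyMeasurable
    (h.measurable_cycle k).aemeasurable).1
    ((h.map_cycle k).symm ▸ integrable_exceedance_cycleLaw hd)

lemma integral_exceedance_cycle (h : IsMM11 P Z X lam mu) (hd : 0 ≤ d) (k : ℕ) :
    ∫ ω, exceedance d (cycle Z X k ω) ∂P = meanExceedance lam mu d := by
  rw [← integral_exceedance_cycleLaw hd, ← h.map_cycle k,
    integral_map (h.measurable_cycle k).aemeasurable
      (measurable_exceedance d).aestronglyMeasurable]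

end IsMM11

end

/-! ### Long-run averages -/

lemma sum_range_eq_sum_residues {β : Type*} [AddCommMonoid β] (f : ℕ → β) {m : ℕ} (hm : 0 < m)
    (n : ℕ) :
    ∑ k ∈ Finset.range n, f k =
      ∑ a ∈ Finset.range m, ∑ i ∈ Finset.range ((n + (m - 1 - a)) / m), f (m * i + a) := by
  rw [← Finset.sum_fiberwise_of_maps_to (g := (· % m)) (t := Finset.range m)
    fun k _ => Finset.mem_range.2 (k.mod_lt hm)]
  refine Finset.sum_congr rfl fun a ha => ?_
  rw [Finset.mem_range] at ha
  have hlt : ∀ i, i < (n + (m - 1 - a)) / m ↔ m * i + a < n := fun i => by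
    rw [← Nat.succ_le_iff, Nat.le_div_iff_mul_le hm, Nat.succ_mul, mul_comm]
    omega
  refine Finset.sum_nbij' (· / m) (m * · + a) (fun k hk => ?_) (fun i hi => ?_) (fun k hk => ?_)
    (fun i _ => ?_) (fun k hk => ?_)
  · obtain ⟨hk, rfl⟩ := Finset.mem_filter.1 hk
    rwa [Finset.mem_range, hlt, Nat.div_add_mod, ← Finset.mem_range]
  · rw [Finset.mem_range, hlt] at hi
    exact Finset.mem_filter.2
      ⟨Finset.mem_range.2 hi, (m.mul_add_mod i a).trans (Nat.mod_eq_of_lt ha)⟩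
  · obtain ⟨-, rfl⟩ := Finset.mem_filter.1 hk
    exact Nat.div_add_mod k m
  · rw [Nat.mul_add_div hm, Nat.div_eq_of_lt ha, add_zero]
  · obtain ⟨-, rfl⟩ := Finset.mem_filter.1 hk
    rw [Nat.div_add_mod]

lemma tendsto_natCast_add_div_div {m : ℕ} (hm : 0 < m) (b : ℕ) :
    Tendsto (fun n : ℕ => (((n + b) / m : ℕ) : ℝ) / n) atTop (𝓝 (1 / m)) := by
  have hm' : (0 : ℝ) < m := Nat.cast_pos.2 hm
  have htop : Tendsto (fun n : ℕ => ((n + b : ℕ) : ℝ) / m) atTop atTop :=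
    (tendsto_natCast_atTop_atTop.comp (tendsto_add_atTop_nat b)).atTop_div_const hm'
  have hshift : Tendsto (fun n : ℕ => ((n + b : ℕ) : ℝ) / n) atTop (𝓝 1) := by
    have := (tendsto_natCast_div_add_atTop (b : ℝ)).inv₀ one_ne_zero
    simpa only [inv_div, inv_one, Nat.cast_add] using this
  have hfloor := ((tendsto_nat_floor_div_atTop (R := ℝ)).comp htop).mul (hshift.div_const (m : ℝ))
  rw [one_mul] at hfloor
  refine hfloor.congr' ?_
  filter_upwards [eventually_gt_atTop 0] with n hn
  have hn' : (n : ℝ) ≠ 0 := Nat.cast_ne_zero.2 hn.ne'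
  have hnb : ((n + b : ℕ) : ℝ) ≠ 0 := Nat.cast_ne_zero.2 (by omega)
  rw [Function.comp_apply, Nat.floor_div_eq_div]
  field_simp

lemma tendsto_average_of_residues {f : ℕ → ℝ} {m : ℕ} (hm : 0 < m) {c : ℝ}
    (h : ∀ a, Tendsto (fun n : ℕ => (∑ i ∈ Finset.range n, f (m * i + a)) / n) atTop (𝓝 c)) :
    Tendsto (fun n : ℕ => (∑ k ∈ Finset.range n, f k) / n) atTop (𝓝 c) := by
  have hresidue : ∀ a : ℕ, Tendsto (fun n : ℕ =>
      (∑ i ∈ Finset.range ((n + (m - 1 - a)) / m), f (m * i + a)) / n) atTop (𝓝 (c * (1 / m))) := by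
    intro a
    have htop : Tendsto (fun n => (n + (m - 1 - a)) / m) atTop atTop :=
      (Nat.tendsto_div_const_atTop hm.ne').comp (tendsto_add_atTop_nat _)
    refine (((h a).comp htop).mul (tendsto_natCast_add_div_div hm (m - 1 - a))).congr' ?_
    filter_upwards [htop.eventually_ne_atTop 0] with n hn
    exact div_mul_div_cancel₀ (Nat.cast_ne_zero.2 hn)
  have hsum := tendsto_finsetSum (Finset.range m) fun a _ => hresidue a
  have hm' : (m : ℝ) ≠ 0 := Nat.cast_ne_zero.2 hm.ne'
  rw [Finset.sum_const, Finset.card_range, nsmul_eq_mul, mul_left_comm, mul_one_div_cancel hm',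
    mul_one] at hsum
  exact hsum.congr fun n => by rw [sum_range_eq_sum_residues f hm, Finset.sum_div]

lemma ae_tendsto_average_of_indepFun_of_add_le {Ω : Type*} [MeasurableSpace Ω] {P : Measure Ω}
    {F : ℕ → Ω → ℝ} {m : ℕ} (hm : 0 < m) (hint : Integrable (F 0) P)
    (hident : ∀ i, IdentDistrib (F i) (F 0) P P)
    (hindep : ∀ i j, i + m ≤ j → IndepFun (F i) (F j) P) :
    ∀ᵐ ω ∂P, Tendsto (fun n : ℕ => (∑ k ∈ Finset.range n, F k ω) / n) atTop
      (𝓝 (∫ ω, F 0 ω ∂P)) := by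
  have hpairwise : ∀ a, Pairwise (Function.onFun (fun U V => IndepFun U V P)
      fun i => F (m * i + a)) := fun a i j hij => by
    wlog hlt : i < j generalizing i j
    · exact (this j i hij.symm (by omega)).symm
    · exact hindep _ _ (by nlinarith [Nat.mul_le_mul_left m (Nat.succ_le_of_lt hlt)])
  have hresidue : ∀ a, ∀ᵐ ω ∂P, Tendsto
      (fun n : ℕ => (∑ i ∈ Finset.range n, F (m * i + a) ω) / n) atTop
      (𝓝 (∫ ω, F 0 ω ∂P)) := fun a => by
    rw [← (hident (m * 0 + a)).integral_eq]
    exact strong_law_ae_real (fun i => F (m * i + a)) ((hident _).integrable_iff.2 hint)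
      (hpairwise a) fun i => (hident _).trans (hident _).symm
  filter_upwards [ae_all_iff.2 hresidue] with ω hω
  exact tendsto_average_of_residues hm hω

lemma tendsto_succ_div_natCast {u : ℕ → ℝ} {a : ℝ}
    (hu : Tendsto (fun n : ℕ => u n / n) atTop (𝓝 a)) :
    Tendsto (fun n : ℕ => u (n + 1) / n) atTop (𝓝 a) := by
  have := (hu.comp (tendsto_add_atTop_nat 1)).div (tendsto_natCast_div_add_atTop (1 : ℝ))
    one_ne_zero
  rw [div_one] at this
  refine this.congr fun n => ?_
  have hn : ((n : ℝ) + 1) ≠ 0 := n.cast_add_one_ne_zero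
  rw [Pi.div_apply, Function.comp_apply, Nat.cast_add_one, div_div_div_cancel_right₀ hn]

lemma tendsto_div_of_tendsto_div_natCast {u v : ℕ → ℝ} {a b : ℝ} (ha : a ≠ 0)
    (hu : Tendsto (fun n : ℕ => u n / n) atTop (𝓝 b))
    (hv : Tendsto (fun n : ℕ => v n / n) atTop (𝓝 a)) :
    Tendsto (fun n => u n / v n) atTop (𝓝 (b / a)) := by
  refine (hu.div hv ha).congr' ?_
  filter_upwards [eventually_ne_atTop 0] with n hn
  exact div_div_div_cancel_right₀ (Nat.cast_ne_zero.2 hn) _ _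

lemma tendsto_div_atTop_of_renewals {M : ℝ → ℝ} (hM : Monotone M) {E : ℕ → ℝ} (hE : Monotone E)
    (hE0 : 0 < E 0) (hM0 : 0 ≤ M (E 0)) {a b : ℝ} (ha : 0 < a)
    (hEa : Tendsto (fun n : ℕ => E n / n) atTop (𝓝 a))
    (hMb : Tendsto (fun n : ℕ => M (E n) / n) atTop (𝓝 b)) :
    Tendsto (fun T => M T / T) atTop (𝓝 (b / a)) := by
  have hEpos : ∀ n, 0 < E n := fun n => hE0.trans_le (hE n.zero_le)
  have hEtop := tendsto_atTop_of_tendsto_div_natCast ha hEa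
  choose! κ hκ using fun T (hT : E 0 ≤ T) => exists_mem_Ico_of_tendsto_atTop hEtop hT
  have hκtop : Tendsto κ atTop atTop := by
    refine tendsto_atTop.2 fun N => ?_
    filter_upwards [eventually_ge_atTop (E N)] with T hT
    exact Nat.le_of_lt_succ
      (hE.reflect_lt (hT.trans_lt (hκ T ((hE N.zero_le).trans hT)).2))
  have hlower : Tendsto (fun n => M (E n) / E (n + 1)) atTop (𝓝 (b / a)) :=
    tendsto_div_of_tendsto_div_natCast ha.ne' hMb (tendsto_succ_div_natCast hEa)
  have hupper : Tendsto (fun n => M (E (n + 1)) / E n) atTop (𝓝 (b / a)) :=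
    tendsto_div_of_tendsto_div_natCast ha.ne'
      (tendsto_succ_div_natCast (u := fun n => M (E n)) hMb) hEa
  refine tendsto_of_tendsto_of_tendsto_of_le_of_le' (hlower.comp hκtop) (hupper.comp hκtop) ?_ ?_
  · filter_upwards [eventually_ge_atTop (E 0)] with T hT
    exact div_le_div₀ (hM0.trans (hM hT)) (hM (hκ T hT).1) (hE0.trans_le hT) (hκ T hT).2.le
  · filter_upwards [eventually_ge_atTop (E 0)] with T hT
    exact div_le_div₀ (hM0.trans (hM (hE (Nat.zero_le _)))) (hM (hκ T hT).2.le) (hEpos _)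
      (hκ T hT).1

lemma tendsto_timeAverage {E : Type*} [NormedAddCommGroup E] [NormedSpace ℝ E]
    [CompleteSpace E] {φ : ℝ → E} (hφ : StronglyMeasurable φ) {C : ℝ} (hC : ∀ t, ‖φ t‖ ≤ C) {p : E}
    (hp : Tendsto φ atTop (𝓝 p)) :
    Tendsto (fun T : ℝ => T⁻¹ • ∫ t in (0 : ℝ)..T, φ t) atTop (𝓝 p) := by
  have hrescaled : Tendsto (fun T => ∫ s in (0 : ℝ)..1, φ (T * s)) atTop
      (𝓝 (∫ _ in (0 : ℝ)..1, p)) := by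
    refine intervalIntegral.tendsto_integral_filter_of_dominated_convergence (fun _ => C)
      (.of_forall fun T => (hφ.comp_measurable (measurable_const_mul T)).aestronglyMeasurable)
      (.of_forall fun T => ae_of_all _ fun s _ => hC _) intervalIntegrable_const
      (ae_of_all _ fun s hs => ?_)
    rw [Set.uIoc_of_le zero_le_one] at hs
    exact hp.comp (tendsto_id.atTop_mul_const hs.1)
  rw [intervalIntegral.integral_const, sub_zero, one_smul] at hrescaled
  refine hrescaled.congr' ?_
  filter_upwards [eventually_ne_atTop 0] with T hT
  rw [intervalIntegral.integral_comp_mul_left _ hT, mul_zero, mul_one]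

section

variable {Ω E : Type*} [MeasurableSpace Ω] {P : Measure Ω} [IsFiniteMeasure P]
  [NormedAddCommGroup E] [NormedSpace ℝ E] {f : ℝ → Ω → E} {C : ℝ}

lemma integral_timeAverage (hf : StronglyMeasurable (Function.uncurry f))
    (hC : ∀ t ω, ‖f t ω‖ ≤ C) (T : ℝ) :
    ∫ ω, T⁻¹ • (∫ t in (0 : ℝ)..T, f t ω) ∂P = T⁻¹ • ∫ t in (0 : ℝ)..T, ∫ ω, f t ω ∂P := by
  have : IsFiniteMeasure (volume.restrict (Set.uIoc 0 T)) :=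
    isFiniteMeasure_restrict.2 measure_Ioc_lt_top.ne
  have hint : Integrable (Function.uncurry f) ((volume.restrict (Set.uIoc 0 T)).prod P) :=
    .of_bound hf.aestronglyMeasurable C (ae_of_all _ fun p => hC p.1 p.2)
  rw [integral_smul, intervalIntegral_integral_swap hint]

lemma tendsto_integral_timeAverage (hf : StronglyMeasurable (Function.uncurry f))
    (hC : ∀ t ω, ‖f t ω‖ ≤ C) {c : E}
    (hc : ∀ᵐ ω ∂P, Tendsto (fun T : ℝ => T⁻¹ • ∫ t in (0 : ℝ)..T, f t ω) atTop (𝓝 c)) :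
    Tendsto (fun T : ℝ => ∫ ω, T⁻¹ • (∫ t in (0 : ℝ)..T, f t ω) ∂P) atTop
      (𝓝 (∫ _, c ∂P)) := by
  refine tendsto_integral_filter_of_dominated_convergence (fun _ => C)
    (.of_forall fun T => ?_) ?_ (integrable_const C) hc
  · simp only [intervalIntegral.intervalIntegral_eq_integral_uIoc]
    exact ((hf.integral_prod_left' (μ := volume.restrict (Set.uIoc 0 T))).const_smul
      _).const_smul _ |>.aestronglyMeasurable
  · filter_upwards [eventually_gt_atTop 0] with T hT
    refine ae_of_all _ fun ω => ?_
    rw [norm_smul, norm_inv, Real.norm_of_nonneg hT.le, inv_mul_le_iff₀ hT, mul_comm]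
    simpa only [sub_zero, abs_of_pos hT] using
      intervalIntegral.norm_integral_le_of_norm_le_const (a := 0) (b := T) fun t _ => hC t ω

end

lemma eq_of_tendsto_integral_of_ae_tendsto_timeAverage {Ω E : Type*} [MeasurableSpace Ω]
    {P : Measure Ω} [IsProbabilityMeasure P] [NormedAddCommGroup E] [NormedSpace ℝ E]
    [CompleteSpace E] {f : ℝ → Ω → E} (hf : StronglyMeasurable (Function.uncurry f)) {C : ℝ}
    (hC : ∀ t ω, ‖f t ω‖ ≤ C) {p c : E} (hp : Tendsto (fun t => ∫ ω, f t ω ∂P) atTop (𝓝 p))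
    (hc : ∀ᵐ ω ∂P, Tendsto (fun T : ℝ => T⁻¹ • ∫ t in (0 : ℝ)..T, f t ω) atTop (𝓝 c)) :
    p = c := by
  have hbound : ∀ t, ‖∫ ω, f t ω ∂P‖ ≤ C := fun t => by
    simpa using norm_integral_le_of_norm_le_const (μ := P) (ae_of_all _ (hC t))
  have haverage := tendsto_integral_timeAverage hf hC hc
  simp only [integral_timeAverage hf hC, integral_const, probReal_univ, one_smul] at haverage
  exact tendsto_nhds_unique (tendsto_timeAverage hf.integral_prod_right hbound hp) haverage

/-! ### The age over long time intervals -/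

section

variable {z x : ℕ → ℝ} {d : ℝ}

/-- Time during `[0, T]` for which the age exceeds `d`. -/
noncomputable def exceedanceMass (z x : ℕ → ℝ) (d T : ℝ) : ℝ :=
  volume.real {t | t ∈ Set.Icc 0 T ∧ d < age z x t}

lemma monotone_exceedanceMass (z x : ℕ → ℝ) (d : ℝ) : Monotone (exceedanceMass z x d) :=
  fun _ _ hST => measureReal_mono (fun _ ht => ⟨⟨ht.1.1, ht.1.2.trans hST⟩, ht.2⟩)
    (measure_ne_top_of_subset (fun _ ht => ht.1) measure_Icc_lt_top.ne)

lemma volume_real_Icc_inter_add_Ico_inter (A : Set ℝ) {a b c : ℝ} (hab : a ≤ b) (hbc : b ≤ c) :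
    volume.real (Set.Icc a b ∩ A) + volume.real (Set.Ico b c ∩ A) =
      volume.real (Set.Icc a c ∩ A) := by
  have hIcc : ∀ b, volume.real (Set.Icc a b ∩ A) = volume.real (Set.Ico a b ∩ A) := fun b =>
    measureReal_congr (Ico_ae_eq_Icc.symm.inter (ae_eq_refl A))
  have hright : Set.Ico a c ∩ A ∩ Set.Ico b c = Set.Ico b c ∩ A := by
    rw [Set.inter_right_comm, Set.inter_eq_right.2 (Set.Ico_subset_Ico_left hab)]
  have hleft : (Set.Ico a c ∩ A) \ Set.Ico b c = Set.Ico a b ∩ A := by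
    ext t
    simp only [Set.mem_sdiff, Set.mem_inter_iff, Set.mem_Ico]
    grind
  have hfinite : volume (Set.Ico a c ∩ A) ≠ ∞ :=
    measure_ne_top_of_subset Set.inter_subset_left measure_Ico_lt_top.ne
  rw [hIcc, hIcc, ← measureReal_inter_add_sdiff (s := Set.Ico a c ∩ A)
    (measurableSet_Ico (a := b) (b := c)) hfinite, hright, hleft, add_comm]

lemma IsRegular.exceedanceMass_departureTime (h : IsRegular z x) (d : ℝ) (n : ℕ) :
    exceedanceMass z x d (departureTime z x n) = exceedanceMass z x d (departureTime z x 0) +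
      ∑ i ∈ Finset.range n, exceedanceTime z x d (i + 1) := by
  induction n with
  | zero => rw [Finset.sum_range_zero, add_zero]
  | succ n ih =>
    rw [Finset.sum_range_succ, ← add_assoc, ← ih]
    exact (volume_real_Icc_inter_add_Ico_inter {t | d < age z x t} (h.departureTime_pos n).le
      (h.strictMono_departureTime n.lt_succ_self).le).symm

end

lemma tendsto_const_add_sum_div {f : ℕ → ℝ} {c : ℝ} (b : ℝ)
    (hf : Tendsto (fun n : ℕ => (∑ i ∈ Finset.range n, f i) / n) atTop (𝓝 c)) :
    Tendsto (fun n : ℕ => (b + ∑ i ∈ Finset.range n, f i) / n) atTop (𝓝 c) := by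
  simpa only [zero_add, ← add_div] using (tendsto_const_div_atTop_nhds_zero_nat b).add hf

lemma IsRegular.tendsto_exceedanceFraction {z x : ℕ → ℝ} {d a b : ℝ} (h : IsRegular z x)
    (ha : 0 < a)
    (hlength : Tendsto (fun n : ℕ => (∑ i ∈ Finset.range n, cycleLength z x i) / n) atTop (𝓝 a))
    (hexceedance : Tendsto (fun n : ℕ => (∑ i ∈ Finset.range n, exceedanceTime z x d (i + 1)) / n)
      atTop (𝓝 b)) :
    Tendsto (exceedanceFraction z x d) atTop (𝓝 (b / a)) := by
  refine tendsto_div_atTop_of_renewals (monotone_exceedanceMass z x d)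
    h.strictMono_departureTime.monotone (h.departureTime_pos 0) measureReal_nonneg ha ?_ ?_
  · simp only [departureTime_eq_sum h.tendsto_sourceArrival]
    exact tendsto_const_add_sum_div _ hlength
  · exact (tendsto_const_add_sum_div _ hexceedance).congr fun n => by
      rw [h.exceedanceMass_departureTime]

section

variable {Ω : Type*} [MeasurableSpace Ω] {P : Measure Ω} {Z X : ℕ → Ω → ℝ} {lam mu d : ℝ}
  [hlam : Fact (0 < lam)] [hmu : Fact (0 < mu)]

namespace IsMM11

lemma ae_tendsto_average_cycle (h : IsMM11 P Z X lam mu) {φ : ℝ × ℝ → ℝ} (hφ : Measurable φ)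
    (hint : Integrable (fun ω => φ (cycle Z X 0 ω)) P) :
    ∀ᵐ ω ∂P, Tendsto (fun n : ℕ => (∑ i ∈ Finset.range n, φ (cycle Z X i ω)) / n) atTop
      (𝓝 (∫ ω, φ (cycle Z X 0 ω) ∂P)) := by
  have hident : ∀ i, IdentDistrib (cycle Z X i) (cycle Z X 0) P P := fun i =>
    ⟨(h.measurable_cycle i).aemeasurable, (h.measurable_cycle 0).aemeasurable,
      (h.map_cycle i).trans (h.map_cycle 0).symm⟩
  exact ae_tendsto_average_of_indepFun_of_add_le (F := fun i ω => φ (cycle Z X i ω)) two_pos hint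
    (fun i => (hident i).comp hφ) fun i j hij => (h.indepFun_cycle hij).comp hφ hφ

lemma ae_tendsto_exceedanceFraction (h : IsMM11 P Z X lam mu) (hd : 0 ≤ d) :
    ∀ᵐ ω ∂P, Tendsto (exceedanceFraction (fun n => Z n ω) (fun n => X n ω) d) atTop
      (𝓝 (meanExceedance lam mu d / (1 / lam + 1 / mu))) := by
  have hlength := h.ae_tendsto_average_cycle measurable_snd (h.integrable_length_cycle 0)
  have hexceedance := h.ae_tendsto_average_cycle (measurable_exceedance d)
    (h.integrable_exceedance_cycle hd 0)
  rw [h.integral_length_cycle] at hlength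
  rw [h.integral_exceedance_cycle hd] at hexceedance
  filter_upwards [h.ae_isRegular, hlength, hexceedance] with ω hω hlengthω hexceedanceω
  refine hω.tendsto_exceedanceFraction
    (add_pos (one_div_pos.2 hlam.out) (one_div_pos.2 hmu.out)) hlengthω ?_
  simp only [hω.exceedanceTime_succ]
  exact hexceedanceω

lemma exists_measurableSet_lt_age (h : IsMM11 P Z X lam mu) (d : ℝ) :
    ∃ S : Set (ℝ × Ω), MeasurableSet S ∧
      ∀ᵐ ω ∂P, ∀ t, d < age (fun n => Z n ω) (fun n => X n ω) t ↔ (t, ω) ∈ S := by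
  set D : ℕ → Ω → ℝ := fun n ω => Z 0 ω + X 0 ω + ∑ i ∈ Finset.range n, (cycle Z X i ω).2
  have hZ := h.measurable_interarrival
  have hX := h.measurable_service
  have hDmeas : ∀ n, Measurable (D n) := fun n => ((hZ 0).add (hX 0)).add
    (Finset.measurable_fun_sum _ fun i _ => (h.measurable_cycle i).snd)
  refine ⟨{p | d < p.1} ∩ ⋂ n, {p | D n p.2 ≤ p.1}ᶜ ∪ {p | D n p.2 + d < X n p.2 + p.1}, ?_, ?_⟩
  · exact (measurableSet_lt (by fun_prop) (by fun_prop)).inter <| MeasurableSet.iInter fun n =>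
      (measurableSet_le (by fun_prop) (by fun_prop)).compl.union
        (measurableSet_lt (by fun_prop) (by fun_prop))
  · filter_upwards [h.ae_isRegular] with ω hω t
    have hD : ∀ n, departureTime (fun n => Z n ω) (fun n => X n ω) n = D n ω :=
      departureTime_eq_sum hω.tendsto_sourceArrival
    simp only [hω.lt_age_iff, hD, Set.mem_inter_iff, Set.mem_iInter, Set.mem_union,
      Set.mem_compl_iff, Set.mem_ofPred_eq, imp_iff_not_or]

lemma eq_of_tendsto_violationProb [IsProbabilityMeasure P] (h : IsMM11 P Z X lam mu) (hd : 0 ≤ d)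
    {p : ℝ} (hp : Tendsto (violationProb P Z X d) atTop (𝓝 p)) :
    p = meanExceedance lam mu d / (1 / lam + 1 / mu) := by
  obtain ⟨S, hS, hage⟩ := h.exists_measurableSet_lt_age d
  set f : ℝ → Ω → ℝ := fun t ω => S.indicator 1 (t, ω)
  have hf : StronglyMeasurable (Function.uncurry f) := stronglyMeasurable_one.indicator hS
  have hbound : ∀ t ω, ‖f t ω‖ ≤ 1 := fun t ω => by
    simpa using norm_indicator_le_norm_self (s := S) (1 : ℝ × Ω → ℝ) (t, ω)
  have hprob : ∀ t, violationProb P Z X d t = ∫ ω, f t ω ∂P := fun t => by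
    refine Eq.trans (measureReal_congr ?_) (integral_indicator_one (hS.preimage
      measurable_prodMk_left)).symm
    filter_upwards [hage] with ω hω
    exact propext (hω t)
  refine eq_of_tendsto_integral_of_ae_tendsto_timeAverage hf hbound (hp.congr hprob) ?_
  filter_upwards [hage, h.ae_tendsto_exceedanceFraction hd] with ω hω hfraction
  refine hfraction.congr' ?_
  filter_upwards [eventually_ge_atTop 0] with T hT
  have hslice : MeasurableSet {t | (t, ω) ∈ S} := hS.preimage measurable_prodMk_right
  have hintegral : ∫ t in (0 : ℝ)..T, f t ω = volume.real (Set.Icc 0 T ∩ {t | (t, ω) ∈ S}) := by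
    rw [intervalIntegral.integral_of_le hT, ← integral_Icc_eq_integral_Ioc, Set.inter_comm,
      ← measureReal_restrict_apply hslice]
    exact integral_indicator_one hslice
  rw [hintegral, exceedanceFraction, smul_eq_mul, inv_mul_eq_div]
  simp only [hω]
  rfl

end IsMM11

end

end AoI

theorem mainTheorem5 {Ω : Type*} [MeasurableSpace Ω] (P : Measure Ω) [IsProbabilityMeasure P]
    (Z X : ℕ → Ω → ℝ) (lam mu d : ℝ) (hlam : 0 < lam) (hmu : 0 < mu) (hd : 0 ≤ d)
    (hMM11 : AoI.IsMM11 P Z X lam mu) (k : ℕ) (hk : 1 ≤ k) :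
    Integrable (AoI.interDeparture Z X k) P ∧
    1 / AoI.departureRate P Z X k = 1 / lam + 1 / mu ∧
    Integrable (AoI.g Z X d k) P ∧
    (lam ≠ mu → ∫ ω, AoI.g Z X d k ω ∂P =
      mu ^ 2 * (Real.exp (-lam * d) - Real.exp (-mu * d)) / (lam * (mu - lam) ^ 2) +
        Real.exp (-mu * d) * (1 / lam + 1 / mu - lam * d / (mu - lam))) ∧
    (lam = mu → ∫ ω, AoI.g Z X d k ω ∂P =
      mu * Real.exp (-mu * d) / 2 * (d + 2 / mu) ^ 2) ∧
    (∀ p : ℝ, Tendsto (fun t => AoI.violationProb P Z X d t) atTop (𝓝 p) →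
      p = AoI.departureRate P Z X k * ∫ ω, AoI.g Z X d k ω ∂P) ∧
    (∀ᵐ ω ∂P, Tendsto
      (fun T => AoI.exceedanceFraction (fun n => Z n ω) (fun n => X n ω) d T) atTop
      (𝓝 (AoI.departureRate P Z X k * ∫ ω', AoI.g Z X d k ω' ∂P))) := by
  have : Fact (0 < lam) := ⟨hlam⟩
  have : Fact (0 < mu) := ⟨hmu⟩
  obtain ⟨j, rfl⟩ := Nat.exists_eq_add_of_le' hk
  have hcycle : ∫ ω, AoI.interDeparture Z X (j + 1) ω ∂P = 1 / lam + 1 / mu :=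
    (integral_congr_ae (hMM11.interDeparture_succ_ae_eq j)).trans (hMM11.integral_length_cycle j)
  have hexceedance : ∫ ω, AoI.g Z X d (j + 1) ω ∂P = AoI.meanExceedance lam mu d :=
    (integral_congr_ae (hMM11.g_succ_ae_eq d j)).trans (hMM11.integral_exceedance_cycle hd j)
  have hlimit : AoI.departureRate P Z X (j + 1) * ∫ ω, AoI.g Z X d (j + 1) ω ∂P =
      AoI.meanExceedance lam mu d / (1 / lam + 1 / mu) := by
    rw [AoI.departureRate, hcycle, hexceedance, one_div_mul_eq_div]
  rw [hlimit, hexceedance]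
  refine ⟨(hMM11.integrable_length_cycle j).congr (hMM11.interDeparture_succ_ae_eq j).symm, ?_,
    (hMM11.integrable_exceedance_cycle hd j).congr (hMM11.g_succ_ae_eq d j).symm,
    fun hne => if_neg hne, fun heq => if_pos heq,
    fun p hp => hMM11.eq_of_tendsto_violationProb hd hp, hMM11.ae_tendsto_exceedanceFraction hd⟩
  rw [AoI.departureRate, hcycle, one_div_one_div]
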